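/- \textbf{Setting.} Let $M$ be a smooth $n$-manifold without boundary ($n\ge 1$) with an auxiliary smooth Riemannian metric $\gamma_0$, whose exponential map is denoted $\exp$. Let $\Gamma$ be a finite weighted multigraph with vertex set $\mathscr V$, edge set $\mathscr E$ and multiplicities $n(E)\ge 1$. Each edge $E$ is identified with $[0,1]$, and $\pi_E(i)\in\mathscr V$ denotes its endpoint $i\in\{0,1\}$. Assume that $\Gamma$ is connected and that every vertex has at least three incoming edge ends (pairs $(E,i)$ with $\pi_E(i)=v$). A $\Gamma$-net is a continuous map $\Gamma\to M$ that is a $C^2$ immersion on every edge; it is embedded if it is injective. \textbf{Chart.} Fix a $\Gamma$-net whose edges $f_E$ are smooth immersions, extended to smooth immersions of $(-\eta_E,1+\eta_E)$, and trivializations $\phi_E:(-\eta_E,1+\eta_E)\times\mathbb R^{n-1}\to N_{f_E}$ of the $\gamma_0$-normal bundles. Set $\Phi_E=\exp\circ\phi_E$. Let $r_E>0$ be such that $\exp$ is defined on $\{|\phi_E|_{\gamma_0}<r_E\}$ and $\Phi_E$ is a local diffeomorphism there. Let $0<\delta_E<\min(\eta_E,\tfrac12)$ be such that $(-\delta_E,1+\delta_E)\times\{|x|<\delta_E\}$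 lies in that region. For each vertex $v$ choose an edge end $(E_v,i_v)$ with $\pi_{E_v}(i_v)=v$, and let $\Phi_{E_v}^{-1}$ be the inverse of $\Phi_{E_v}$ restricted to a neighborhood of $(i_v,0)$ on which it is a diffeomorphism onto an open set. Write $B_{E,i}=\{(s,x):|s-i|<\delta_E,\ |x|<\delta_E\}$; the $\delta_E$ are so small that $B_{E_v,i_v}$ lies in this neighborhood and that $\Phi_E(B_{E,i})$ lies in the domain of $\Phi_{E_v}^{-1}$ whenever $\pi_E(i)=v$. Let $$U=\prod_{E}(-\delta_E,\delta_E)\times(1-\delta_E,1+\delta_E)\times\{u_E:\|u_E\|_{C^2}<\delta_E\}\subseteq\mathcal B=\prod_{E}\mathbb R^2\times C^2([0,1],\mathbb R^{n-1}).$$ A point $u=(a_E,b_E,u_E)_E\in U$ represents the maps $t\mapsto\Phi_E(a_E(1-t)+b_Et,u_E(t))$. Write $c_0(E)=a_E$ and $c_1(E)=b_E$. Let $C(u)$ have the components $$\Phi_{E_v}^{-1}\big(\Phi_E(c_i(E),u_E(i))\big)-(c_{i_v}(E_v),u_{E_v}(i_v)),\qquad v=\pi_E(i),\ (E,i)\ne(E_v,i_v).$$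 Put $C_0=\{u\in U:C(u)=0\}$ (the coordinates of the $\Gamma$-nets) and $T_uC_0=\ker DC_u$. Assume that every $u\in C_0$ represents an embedded $\Gamma$-net. \textbf{Mean curvature map.} For a $C^k$ Riemannian metric $g$ on $M$, with $k\in\mathbb N_{\ge3}\cup\{\infty\}$, let $L_g^E(t,a,b,x,w)=\big|d\Phi_E(a(1-t)+bt,x)(b-a,w)\big|_g$, with partial gradients $\nabla_u L_g^E$ in $x$ and $\nabla_w L_g^E$ in $w$. Evaluating along $(t,a_E,b_E,u_E(t),\dot u_E(t))$, put $$H_g^{1,E}(u)=n(E)\Big(\nabla_uL_g^E-\tfrac{d}{dt}\nabla_wL_g^E\Big)\in C^0([0,1],\mathbb R^{n-1}),$$ $$A_g^{0,E}(u)=n(E)\Big(\int_0^1\partial_aL_g^E\,dt,\,-\nabla_wL_g^E\big|_{t=0}\Big),\quad A_g^{1,E}(u)=n(E)\Big(\int_0^1\partial_bL_g^E\,dt,\,\nabla_wL_g^E\big|_{t=1}\Big),$$ $$H_g^{2,v}(u)=\sum_{(E,i):\pi_E(i)=v}T_v^{(E,i)}(u)^*A_g^{i,E}(u)\in\mathbb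 R^n,$$ where $T_v^{(E,i)}(u)$ is the inverse of $D(\Phi_{E_v}^{-1}\circ\Phi_E)$ at $(c_i(E),u_E(i))$ and $*$ is the Euclidean adjoint. Set $$H(g,u)=\big((H^{1,E}_g(u))_E,(H^{2,v}_g(u))_v\big)\in\mathcal Y=\Big[\prod_{E}C^0([0,1],\mathbb R^{n-1})\Big]\times(\mathbb R^n)^{|\mathscr V|}.$$ \textbf{Proposition} \label{Prop Fredholm}. The map $H(g,\cdot)$ is well defined on $U$. If $u_0\in C_0$ satisfies $H(g,u_0)=0$, then $C$ and $H(g,\cdot)$ are differentiable at $u_0$, and $$D_2H_{(g,u_0)}:T_{u_0}C_0\to\Big[\prod_{E\in\mathscr E}C^0([0,1],\mathbb R^{n-1})\Big]\times(\mathbb R^n)^{|\mathscr V|},$$ the restriction to $T_{u_0}C_0$ of the derivative of $H(g,\cdot)$ at $u_0$, is a Fredholm operator of index $0$. -/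

import Mathlib

open Set Topology Manifold Bundle
open scoped ContDiff

noncomputable section

/-! ### Function spaces -/

/-- The Euclidean space `ℝ^m`, which plays the role of `ℝ^{n-1}` with `n = m + 1`. -/
abbrev Euc (m : ℕ) : Type := EuclideanSpace ℝ (Fin m)

/-- `ℝ^n = ℝ × ℝ^{n-1}` with its Euclidean inner product (`n = m + 1`). -/
abbrev Rn (m : ℕ) : Type := WithLp 2 (ℝ × Euc m)

/-- Real-variable extension of a map on `[0,1]`, constant outside of `[0,1]`. -/
def extendI {F : Type*} [TopologicalSpace F] (u : C(unitInterval, F)) : ℝ → F :=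
  Set.IccExtend zero_le_one u

/-- The space `C²([0,1], ℝ^m)`. An element is the triple `(u, u', u'')` of a `C²` map and
its first two derivatives (one-sided at the endpoints); the norm is the maximum of the three sup
norms. -/
def C2Submodule (m : ℕ) :
    Submodule ℝ (C(unitInterval, Euc m) × C(unitInterval, Euc m) × C(unitInterval, Euc m)) where
  carrier := {p | ∀ t : unitInterval,
    HasDerivWithinAt (extendI p.1) (p.2.1 t) (Icc 0 1) t ∧
    HasDerivWithinAt (extendI p.2.1) (p.2.2 t) (Icc 0 1) t}
  add_mem' := fun {_ _} hp hq t => ⟨(hp t).1.add (hq t).1, (hp t).2.add (hq t).2⟩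
  zero_mem' := fun _ => ⟨hasDerivWithinAt_const _ _ _, hasDerivWithinAt_const _ _ _⟩
  smul_mem' := fun c _ hp t => ⟨(hp t).1.const_smul c, (hp t).2.const_smul c⟩

/-- The Banach space `C²([0,1], ℝ^m)`. -/
def C2Path (m : ℕ) : Type := C2Submodule m

instance (m : ℕ) : NormedAddCommGroup (C2Path m) :=
  inferInstanceAs (NormedAddCommGroup (C2Submodule m))

instance (m : ℕ) : NormedSpace ℝ (C2Path m) :=
  inferInstanceAs (NormedSpace ℝ (C2Submodule m))

/-- The value `u(t)`. -/
def pathVal {m : ℕ} (u : C2Path m) (t : ℝ) : Euc m := extendI (Subtype.val u).1 t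

/-- The derivative `u'(t)`. -/
def pathDer {m : ℕ} (u : C2Path m) (t : ℝ) : Euc m := extendI (Subtype.val u).2.1 t

open Classical in
/-- The element of `C⁰([0,1], F)` given by a function that is continuous on `[0,1]`
(and `0` if the function is not continuous there). -/
def toC0 {F : Type*} [TopologicalSpace F] [Zero F] (h : ℝ → F) : C(unitInterval, F) :=
  if hc : ContinuousOn h (Icc 0 1) then ⟨fun t => h t, hc.domRestrict⟩ else 0

/-! ### Weighted multigraphs -/

/-- A weighted multigraph with vertex set `V` and edge set `E`: every edge is identified with
`[0,1]`, `ends e i` is the vertex at the endpoint `i ∈ {0,1}` of the edge `e`, and `mult e ≥ 1` is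
the multiplicity of `e`. Loops and parallel edges are allowed. -/
structure WeightedMultigraph (V E : Type*) where
  ends : E → Fin 2 → V
  mult : E → ℕ
  mult_pos : ∀ e, 0 < mult e

namespace WeightedMultigraph

variable {V E : Type*} (Γ : WeightedMultigraph V E)

/-- The vertex at the edge end `p = (e, i)`. -/
def vertex (p : E × Fin 2) : V := Γ.ends p.1 p.2

/-- `Γ` is good*: it is connected and there are at least three incoming edge ends at every
vertex. -/
def IsGoodStar : Prop :=
  (SimpleGraph.fromRel fun v w => ∃ e, Γ.ends e 0 = v ∧ Γ.ends e 1 = w).Connected ∧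
  ∀ v, 3 ≤ Nat.card {p : E × Fin 2 // Γ.vertex p = v}

/-- The endpoint `i ∈ {0,1}` of the interval `[0,1]`. -/
def endpoint (i : Fin 2) : unitInterval := if i = 0 then 0 else 1

/-- The pairs `(e,t)` and `(e',t')` of `E × [0,1]` are the same point of the topological realization
of `Γ`. -/
def SamePoint (e : E) (t : unitInterval) (e' : E) (t' : unitInterval) : Prop :=
  (e = e' ∧ t = t') ∨
  ∃ i i', t = endpoint i ∧ t' = endpoint i' ∧ Γ.ends e i = Γ.ends e' i'

end WeightedMultigraph

/-! ### Riemannian metrics, geodesics and the exponential map -/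

section Riemannian

variable {m : ℕ} {M : Type*} [TopologicalSpace M] [ChartedSpace (Euc (m + 1)) M]
  [IsManifold (𝓡 (m + 1)) ∞ M]

/-- `C^k` Riemannian metrics on the `(m+1)`-dimensional manifold `M`. -/
abbrev CkMetric (m : ℕ) (M : Type*) [TopologicalSpace M] [ChartedSpace (Euc (m + 1)) M]
    [IsManifold (𝓡 (m + 1)) ∞ M] (k : ℕ∞) :=
  ContMDiffRiemannianMetric (𝓡 (m + 1)) (k : WithTop ℕ∞) (Euc (m + 1))
    (fun x : M => TangentSpace (𝓡 (m + 1)) x)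

/-- The velocity vector of a curve. -/
def velocity (c : ℝ → M) (t : ℝ) : TangentSpace (𝓡 (m + 1)) (c t) :=
  mfderiv 𝓘(ℝ, ℝ) (𝓡 (m + 1)) c t (1 : ℝ)

/-- The metric `γ` in the coordinates of the preferred chart at `x₀`, evaluated at the coordinate
point `z` on the coordinate vectors `v`, `w`. -/
def coordMetric {k : ℕ∞} (γ : CkMetric m M k) (x₀ : M) (z v w : Euc (m + 1)) : ℝ :=
  γ.inner ((extChartAt (𝓡 (m + 1)) x₀).symm z)
    (mfderiv 𝓘(ℝ, Euc (m + 1)) (𝓡 (m + 1)) (extChartAt (𝓡 (m + 1)) x₀).symm z v)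
    (mfderiv 𝓘(ℝ, Euc (m + 1)) (𝓡 (m + 1)) (extChartAt (𝓡 (m + 1)) x₀).symm z w)

/-- `c` is a smooth `γ`-geodesic on the open set `J ⊆ ℝ`: at each time `t₀`, in the coordinates
`y` of the chart at `c t₀`, it satisfies the geodesic equation in the form
`d/dt (γ_{ij}(y) y'^i) = ½ ∂_j γ_{il}(y) y'^i y'^l` for all `j`, which after expanding the
derivative and raising the index is `y''^j + Γ^j_{il} y'^i y'^l = 0`. -/
def IsGeodesicOn {k : ℕ∞} (γ : CkMetric m M k) (c : ℝ → M) (J : Set ℝ) : Prop :=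
  ContMDiffOn 𝓘(ℝ, ℝ) (𝓡 (m + 1)) ∞ c J ∧
  ∀ t₀ ∈ J, ∀ y : ℝ → Euc (m + 1), (y = fun t => extChartAt (𝓡 (m + 1)) (c t₀) (c t)) →
    ∀ ξ : Euc (m + 1),
      deriv (fun t => coordMetric γ (c t₀) (y t) (deriv y t) ξ) t₀ =
        (1 / 2) * fderiv ℝ (fun z => coordMetric γ (c t₀) z (deriv y t₀) (deriv y t₀)) (y t₀) ξ

/-- `q` is the endpoint at time `1` of a `γ`-geodesic with initial position and velocity `X`. -/
def IsExp {k : ℕ∞} (γ : CkMetric m M k) (X : TangentBundle (𝓡 (m + 1)) M) (q : M) : Prop :=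
  ∃ (c : ℝ → M) (ε : ℝ), 0 < ε ∧ IsGeodesicOn γ c (Ioo (-ε) (1 + ε)) ∧
    (⟨c 0, velocity c 0⟩ : TangentBundle (𝓡 (m + 1)) M) = X ∧ c 1 = q

open Classical in
/-- The exponential map of `γ`. It is only meaningful at those `X` for which the geodesic with
initial velocity `X` exists up to time `1`; elsewhere its value is the base point of `X`. -/
def expMap {k : ℕ∞} (γ : CkMetric m M k) (X : TangentBundle (𝓡 (m + 1)) M) : M :=
  if h : ∃ q, IsExp γ X q then h.choose else X.proj

end Riemannian

/-! ### The local charts -/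

section Charts

variable {m : ℕ} {M : Type*} [TopologicalSpace M] [ChartedSpace (Euc (m + 1)) M]
  [IsManifold (𝓡 (m + 1)) ∞ M] {V E : Type*}

/-- For `δ > 0` and `i ∈ {0,1}`, the points `(s,x) ∈ ℝ × ℝ^{n-1}` with `|s - i| < δ`, `|x| < δ`. -/
def endBox (m : ℕ) (δ : ℝ) (i : Fin 2) : Set (Rn m) :=
  {z | |z.fst - (WeightedMultigraph.endpoint i : ℝ)| < δ ∧ ‖z.snd‖ < δ}

/-- The tubular coordinates of one edge before the choice of radii: a curve `f`, smooth immersion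
on `(-η, 1+η)`, together with a trivialization `φ` of its `γ₀`-normal bundle. -/
structure EdgeFrame (γ₀ : CkMetric m M ⊤) where
  η : ℝ
  η_pos : 0 < η
  f : ℝ → M
  f_smooth : ContMDiffOn 𝓘(ℝ, ℝ) (𝓡 (m + 1)) ∞ f (Ioo (-η) (1 + η))
  f_immersion : ∀ t ∈ Ioo (-η) (1 + η), velocity (m := m) f t ≠ 0
  φ : ∀ t : ℝ, Euc m →L[ℝ] TangentSpace (𝓡 (m + 1)) (f t)
  φ_injective : ∀ t ∈ Ioo (-η) (1 + η), Function.Injective (φ t)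
  φ_range : ∀ t ∈ Ioo (-η) (1 + η),
    Set.range (φ t) = {w | γ₀.inner (f t) (velocity (m := m) f t) w = 0}
  φ_smooth : ContMDiffOn 𝓘(ℝ, Rn m) (𝓡 (m + 1)).tangent ∞
    (fun z : Rn m => (⟨f z.fst, φ z.fst z.snd⟩ : TangentBundle (𝓡 (m + 1)) M))
    {z | z.fst ∈ Ioo (-η) (1 + η)}

namespace EdgeFrame

variable {γ₀ : CkMetric m M ⊤} (𝓕 : EdgeFrame γ₀)

/-- The trivialization `φ : (-η, 1+η) × ℝ^{n-1} → N_f ⊆ TM`. -/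
def triv (z : Rn m) : TangentBundle (𝓡 (m + 1)) M := ⟨𝓕.f z.fst, 𝓕.φ z.fst z.snd⟩

/-- The map `Φ = exp ∘ φ`, where `exp` is the exponential map of `γ₀`. -/
def tube (z : Rn m) : M := expMap γ₀ (𝓕.triv z)

/-- The points `z` of `(-η, 1+η) × ℝ^{n-1}` with `|φ(z)|_{γ₀} < r`. -/
def tubeDomain (r : ℝ) : Set (Rn m) :=
  {z | z.fst ∈ Ioo (-𝓕.η) (1 + 𝓕.η) ∧
    γ₀.inner (𝓕.f z.fst) (𝓕.φ z.fst z.snd) (𝓕.φ z.fst z.snd) < r ^ 2}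

end EdgeFrame

/-- The data of a local chart of the space of `Γ`-nets centered at a `Γ`-net whose edges are smooth
immersions. -/
structure NetChart (Γ : WeightedMultigraph V E) (γ₀ : CkMetric m M ⊤) where
  /-- The edges of the central net and the trivializations of their normal bundles. -/
  frame : E → EdgeFrame γ₀
  /-- The central net is continuous on `Γ`. -/
  center_continuous : ∀ e i e' i', Γ.ends e i = Γ.ends e' i' →
    (frame e).f (WeightedMultigraph.endpoint i) = (frame e').f (WeightedMultigraph.endpoint i')
  /-- The radius `r` of the tubular neighborhood of each edge. -/
  r : E → ℝ
  r_pos : ∀ e, 0 < r e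
  exp_defined : ∀ e, ∀ z ∈ (frame e).tubeDomain (r e), ∃ q, IsExp γ₀ ((frame e).triv z) q
  tube_localDiffeo : ∀ e, IsLocalDiffeomorphOn 𝓘(ℝ, Rn m) (𝓡 (m + 1)) ∞ (frame e).tube
    ((frame e).tubeDomain (r e))
  /-- The size of the chart domain. -/
  δ : E → ℝ
  δ_pos : ∀ e, 0 < δ e
  δ_lt_η : ∀ e, δ e < (frame e).η
  δ_lt_half : ∀ e, δ e < 1 / 2
  box_subset : ∀ e, ∀ z : Rn m, z.fst ∈ Ioo (-δ e) (1 + δ e) → ‖z.snd‖ < δ e →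
    z ∈ (frame e).tubeDomain (r e)
  /-- The preferred edge end `(E_v, i_v)` at each vertex `v`. -/
  pref : V → E × Fin 2
  vertex_pref : ∀ v, Γ.vertex (pref v) = v
  /-- The diffeomorphism given by `Φ_{E_v}` on a neighborhood of `(i_v, 0)`. -/
  loc : V → PartialDiffeomorph 𝓘(ℝ, Rn m) (𝓡 (m + 1)) (Rn m) M ∞
  loc_eq : ∀ v, EqOn (loc v) (frame (pref v).1).tube (loc v).source
  loc_source : ∀ v, endBox m (δ (pref v).1) (pref v).2 ⊆ (loc v).source
  loc_target : ∀ p : E × Fin 2, ∀ z ∈ endBox m (δ p.1) p.2,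
    (frame p.1).tube z ∈ (loc (Γ.vertex p)).target

/-- The Banach space `𝓑 = ∏_E ℝ² × C²([0,1], ℝ^{n-1})` of triples `(a_E, b_E, u_E)`. -/
abbrev ModelSpace (E : Type*) (m : ℕ) := E → ℝ × ℝ × C2Path m

/-- The target `𝓨 = (∏_E C⁰([0,1], ℝ^{n-1})) × (ℝ^n)^V` of the mean curvature map. -/
abbrev TargetSpace (V E : Type*) (m : ℕ) := (E → C(unitInterval, Euc m)) × (V → Rn m)

namespace NetChart

variable {Γ : WeightedMultigraph V E} {γ₀ : CkMetric m M ⊤} (𝒞 : NetChart Γ γ₀)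

/-- The map `Φ_E = exp ∘ φ_E` of the edge `e`. -/
def tube (e : E) : Rn m → M := (𝒞.frame e).tube

/-- The chart domain `U = ∏_E (-δ_E, δ_E) × (1 - δ_E, 1 + δ_E) × {‖u‖_{C²} < δ_E}`. -/
def U : Set (ModelSpace E m) :=
  {u | ∀ e, |(u e).1| < 𝒞.δ e ∧ |(u e).2.1 - 1| < 𝒞.δ e ∧ ‖(u e).2.2‖ < 𝒞.δ e}

/-- The path of maps represented by `u`: on the edge `e` it is
`t ↦ Φ_E(a_E (1 - t) + b_E t, u_E(t))`. -/
def net (u : ModelSpace E m) (e : E) (t : ℝ) : M :=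
  𝒞.tube e (WithLp.toLp 2 ((u e).1 * (1 - t) + (u e).2.1 * t, pathVal (u e).2.2 t))

/-- `c_i(E)`: `a_E` if `i = 0` and `b_E` if `i = 1`. -/
def endParam (u : ModelSpace E m) (p : E × Fin 2) : ℝ :=
  if p.2 = 0 then (u p.1).1 else (u p.1).2.1

/-- The point `(c_i(E), u_E(i))` of `ℝ^n`, for an edge end `p = (E, i)`. -/
def endCoord (u : ModelSpace E m) (p : E × Fin 2) : Rn m :=
  WithLp.toLp 2 (endParam u p, pathVal (u p.1).2.2 (WeightedMultigraph.endpoint p.2))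

/-- `Φ_{E_v}⁻¹ ∘ Φ_E` with `v` the vertex at the edge end `p = (E, i)`. -/
def change (p : E × Fin 2) (z : Rn m) : Rn m :=
  (𝒞.loc (Γ.vertex p)).symm (𝒞.tube p.1 z)

/-- The continuity defect `C`: for every edge end `p = (E, i)` that is not the preferred one at its
vertex `v`, `Φ_{E_v}⁻¹(Φ_E(c_i(E), u_E(i))) - (c_{i_v}(E_v), u_{E_v}(i_v))`. -/
def defect (u : ModelSpace E m) (p : {p : E × Fin 2 // p ≠ 𝒞.pref (Γ.vertex p)}) : Rn m :=
  𝒞.change p.1 (endCoord u p.1) - endCoord u (𝒞.pref (Γ.vertex p.1))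

/-- `C₀ = C⁻¹(0) ⊆ U`, the coordinate image of the space of `Γ`-nets. -/
def C₀ : Set (ModelSpace E m) := {u | u ∈ 𝒞.U ∧ 𝒞.defect u = 0}

/-- All `Γ`-nets in the chart domain are embedded, that is, injective on `Γ`. -/
def IsEmbedded : Prop :=
  ∀ u ∈ 𝒞.C₀, ∀ (e e' : E) (t t' : unitInterval),
    𝒞.net u e t = 𝒞.net u e' t' → Γ.SamePoint e t e' t'

/-- `F_g^E(z, w) = |dΦ_E(z) w|_g`. -/
def speed {k : ℕ∞} (g : CkMetric m M k) (e : E) (z w : Rn m) : ℝ :=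
  Real.sqrt (g.inner (𝒞.tube e z)
    (mfderiv 𝓘(ℝ, Rn m) (𝓡 (m + 1)) (𝒞.tube e) z w)
    (mfderiv 𝓘(ℝ, Rn m) (𝓡 (m + 1)) (𝒞.tube e) z w))

/-- The Lagrangian `L_g^E(t, a, b, x, w) = F_g^E((a (1 - t) + b t, x), (b - a, w))` of the length
functional. -/
def lagr {k : ℕ∞} (g : CkMetric m M k) (e : E) (t a b : ℝ) (x w : Euc m) : ℝ :=
  𝒞.speed g e (WithLp.toLp 2 (a * (1 - t) + b * t, x)) (WithLp.toLp 2 (b - a, w))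

/-- `∇_u L_g^E` along `u`, as a function of `t`. -/
def gradU {k : ℕ∞} (g : CkMetric m M k) (u : ModelSpace E m) (e : E) (t : ℝ) : Euc m :=
  gradient (fun x => 𝒞.lagr g e t (u e).1 (u e).2.1 x (pathDer (u e).2.2 t)) (pathVal (u e).2.2 t)

/-- `∇_w L_g^E` along `u`, as a function of `t`. -/
def gradW {k : ℕ∞} (g : CkMetric m M k) (u : ModelSpace E m) (e : E) (t : ℝ) : Euc m :=
  gradient (fun w => 𝒞.lagr g e t (u e).1 (u e).2.1 (pathVal (u e).2.2 t) w) (pathDer (u e).2.2 t)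

/-- `∂L_g^E/∂a` (for `i = 0`) or `∂L_g^E/∂b` (for `i = 1`) along `u`, as a function of `t`. -/
def dEnd {k : ℕ∞} (g : CkMetric m M k) (u : ModelSpace E m) (p : E × Fin 2) (t : ℝ) : ℝ :=
  if p.2 = 0 then
    deriv (fun a => 𝒞.lagr g p.1 t a (u p.1).2.1 (pathVal (u p.1).2.2 t) (pathDer (u p.1).2.2 t)) (u p.1).1
  else
    deriv (fun b => 𝒞.lagr g p.1 t (u p.1).1 b (pathVal (u p.1).2.2 t) (pathDer (u p.1).2.2 t)) (u p.1).2.1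

/-- The Euler-Lagrange expression `n(E) (∇_u L - d/dt ∇_w L)` along `u`, as a function of `t`. -/
def eulerLagrange {k : ℕ∞} (g : CkMetric m M k) (u : ModelSpace E m) (e : E) (t : ℝ) : Euc m :=
  (Γ.mult e : ℝ) • (𝒞.gradU g u e t - derivWithin (𝒞.gradW g u e) (Icc 0 1) t)

/-- The edge component `H^{1,E}_g(u) ∈ C⁰([0,1], ℝ^{n-1})`. -/
def H1 {k : ℕ∞} (g : CkMetric m M k) (u : ModelSpace E m) (e : E) : C(unitInterval, Euc m) :=
  toC0 (𝒞.eulerLagrange g u e)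

/-- The boundary term at the edge end `p = (E, i)`: `n(E) (∫ ∂L/∂a, - ∇_w L(0))` for `i = 0` and
`n(E) (∫ ∂L/∂b, ∇_w L(1))` for `i = 1`. -/
def A {k : ℕ∞} (g : CkMetric m M k) (u : ModelSpace E m) (p : E × Fin 2) : Rn m :=
  (Γ.mult p.1 : ℝ) • WithLp.toLp 2
    (∫ t in (0 : ℝ)..1, 𝒞.dEnd g u p t,
      if p.2 = 0 then -𝒞.gradW g u p.1 0 else 𝒞.gradW g u p.1 1)

/-- The linear map `T_v^{(E,i)}(u)` of `ℝ^n`, inverse of the derivative of `Φ_{E_v}⁻¹ ∘ Φ_E` at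
`(c_i(E), u_E(i))`; a vector `X` of `𝓑` is in the kernel of the derivative of the continuity defect
at `u` iff `T_v^{(E,i)}(u)` always maps its `(E_v, i_v)`-end coordinates to its `(E,i)`-end
coordinates. -/
def T (u : ModelSpace E m) (p : E × Fin 2) : Rn m →L[ℝ] Rn m :=
  (fderiv ℝ (𝒞.change p) (endCoord u p)).inverse

section Fintype

variable [Fintype E]

/-- The vertex component `H^{2,v}_g(u) = ∑_{(E,i) : π_E(i) = v} T_v^{(E,i)}(u)^* A^{i,E}_g(u)`. -/
def H2 [DecidableEq V] {k : ℕ∞} (g : CkMetric m M k) (u : ModelSpace E m) (v : V) : Rn m :=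
  ∑ p : E × Fin 2 with Γ.vertex p = v, (𝒞.T u p).adjoint (𝒞.A g u p)

/-- The mean curvature map `H(g, u) = (H¹_g(u), H²_g(u))`. -/
def H [DecidableEq V] {k : ℕ∞} (g : CkMetric m M k) (u : ModelSpace E m) : TargetSpace V E m :=
  (𝒞.H1 g u, 𝒞.H2 g u)

/-- All the expressions that enter `H(g, u)` make sense: the Lagrangian is differentiable along
`u`, the integrands in the boundary terms are integrable, `∇_w L` is differentiable in `t`, the
Euler-Lagrange expression is continuous in `t`, and the derivatives that are inverted in the
definition of the maps `T_v^{(E,i)}(u)` exist and are invertible. -/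
def IsDefinedAt {k : ℕ∞} (g : CkMetric m M k) (u : ModelSpace E m) : Prop :=
  ∀ e,
    (∀ t ∈ Icc (0 : ℝ) 1,
      DifferentiableAt ℝ
        (fun q : ℝ × ℝ × Euc m × Euc m => 𝒞.lagr g e t q.1 q.2.1 q.2.2.1 q.2.2.2)
        ((u e).1, (u e).2.1, pathVal (u e).2.2 t, pathDer (u e).2.2 t)) ∧
    (∀ i, IntervalIntegrable (𝒞.dEnd g u (e, i)) MeasureTheory.volume 0 1) ∧
    DifferentiableOn ℝ (𝒞.gradW g u e) (Icc 0 1) ∧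
    ContinuousOn (𝒞.eulerLagrange g u e) (Icc 0 1) ∧
    (∀ i, DifferentiableAt ℝ (𝒞.change (e, i)) (endCoord u (e, i)) ∧
      (fderiv ℝ (𝒞.change (e, i)) (endCoord u (e, i))).IsInvertible)

variable [DecidableEq E] [DecidableEq V]

/-- The tangent space `T_u C₀ = ker DC_u`. -/
def tangent (u : ModelSpace E m) : Submodule ℝ (ModelSpace E m) :=
  (fderiv ℝ 𝒞.defect u).ker

variable [Fintype V]

/-- The partial derivative `D₂H_{(g,u)} : T_u C₀ → 𝓨`. -/
def D₂H {k : ℕ∞} (g : CkMetric m M k) (u : ModelSpace E m) :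
    𝒞.tangent u →L[ℝ] TargetSpace V E m :=
  (fderiv ℝ (𝒞.H g) u).comp (𝒞.tangent u).subtypeL

end Fintype

end NetChart

end Charts

/-- A continuous linear map is Fredholm of index `0`. -/
def IsFredholmOfIndexZero {X Y : Type*} [AddCommGroup X] [Module ℝ X] [TopologicalSpace X]
    [AddCommGroup Y] [Module ℝ Y] [TopologicalSpace Y] (T : X →L[ℝ] Y) : Prop :=
  T.IsFredholm ∧ (Module.finrank ℝ T.ker : ℤ) - Module.finrank ℝ (Y ⧸ T.range) = 0

end

/-!
The proof is an index count for a boundary value problem for ordinary differential equations. No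
compactness is used.

*The mean curvature map is differentiable.* In the tube of an edge the metric pulls back to a `C³`
family of inner products (`contDiffOn_metric_mfderiv`), so the Lagrangian is of class `C³` where the
velocity does not vanish (`NetChart.contDiffOn_lagrFun`). The expression `∇_u L - d/dt ∇_w L` is
then a `C¹` function `eulerLagrangeMap` of the second-order data `((t, a, b, u, u'), u'')` of an
edge, and a `C¹` function acts differentiably on continuous curves (`hasFDerivAt_superposition`).
The vertex components involve integrals and point values of such expressions and the inverses of the
derivatives of the smooth coordinate changes `Φ_{E_v}⁻¹ ∘ Φ_E`.

*The linearized edge equations.* On each edge the derivative of `H¹` is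
`(α, β, X) ↦ A X'' + B X' + C X + α p + β q` with continuous coefficients. The leading coefficient
`A` is minus a multiple of the Hessian of `L` in the velocity. By the strict Cauchy-Schwarz
inequality it is invertible, since the component `b - a` of the velocity along the edge does not
vanish (`NetChart.eq_zero_of_fderiv_gradVel_lagrFun_eq_zero`). Hence the initial value problem is
uniquely solvable (`bijective_edgeJet_edgeInit`): in terms of `X''` it is an equation
`(1 + K) z = r` with a quasi-nilpotent Volterra operator `K` (`isUnit_one_add_of_volterra`).
In particular `D₂H¹` is surjective on the whole model space, and its kernel is parametrized by the
data `α`, `β`, `X(0)`, `X'(0)` on the edges, so it has dimension `2n|E|`.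

*The count.* The derivative of the continuity defect is onto a space of dimension `n(2|E| - |V|)`,
because the end coordinates at the edge ends can be prescribed independently and the coordinate
changes are invertible (`NetChart.defectDeriv_surjective`). The vertex components take values in a
space of dimension `n|V|`. So the finitely many remaining conditions on the kernel of `D₂H¹` are as
many as its dimension, and the index is `0` (`isFredholmOfIndexZero_prod_comp_subtypeL`). That
kernels and cokernels of finite dimension suffice for the Fredholm property is a consequence of the
open mapping theorem (`ContinuousLinearMap.isFredholm_of_finiteDimensional`).
-/

noncomputable section

/-! ### Fredholm operators between Banach spaces -/

/-- Between Banach spaces, the topological conditions in the definition of a Fredholm operator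
follow from the finiteness of the kernel and of the cokernel, by the open mapping theorem. -/
theorem ContinuousLinearMap.isFredholm_of_finiteDimensional {X Y : Type*}
    [NormedAddCommGroup X] [NormedSpace ℝ X] [CompleteSpace X]
    [NormedAddCommGroup Y] [NormedSpace ℝ Y] [CompleteSpace Y] (u : X →L[ℝ] Y)
    [FiniteDimensional ℝ u.ker] [FiniteDimensional ℝ (Y ⧸ u.range)] : u.IsFredholm := by
  obtain ⟨X₁, hX₁, hc⟩ :=
    (Submodule.ClosedComplemented.of_finiteDimensional u.ker).exists_isClosed_isCompl
  have : CompleteSpace X₁ := hX₁.completeSpace_coe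
  have hinj : (u.comp X₁.subtypeL).ker = ⊥ := by
    rw [LinearMap.ker_eq_bot']
    intro x hx
    have : (x : X) ∈ u.ker ⊓ X₁ := ⟨hx, x.2⟩
    rw [hc.inf_eq_bot] at this
    exact Subtype.ext (by simpa using this)
  have hrange : (u.comp X₁.subtypeL).range = u.range := by
    apply le_antisymm
    · rintro _ ⟨x, rfl⟩
      exact ⟨x, rfl⟩
    · rintro _ ⟨x, rfl⟩
      obtain ⟨k, hk, y, hy, rfl⟩ := Submodule.mem_sup.1
        (show x ∈ u.ker ⊔ X₁ by rw [hc.sup_eq_top]; trivial)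
      refine ⟨⟨y, hy⟩, ?_⟩
      have hk' : u k = 0 := hk
      simp [hk']
  obtain ⟨G, hG⟩ := u.range.exists_isCompl
  have : FiniteDimensional ℝ G :=
    (Submodule.quotientEquivOfIsCompl _ _ hG).finiteDimensional
  have hcl : IsClosed (u.range : Set Y) := by
    have := (u.comp X₁.subtypeL).closed_complemented_range_of_isCompl_of_ker_eq_bot G
      (by rw [hrange]; exact hG) G.closed_of_finiteDimensional hinj
    rwa [hrange] at this
  have : CompleteSpace u.range := hcl.completeSpace_coe
  have hmaps : MapsTo u X₁ u.range := fun x _ => ⟨x, rfl⟩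
  have : X₁.CoFG := by
    rw [Submodule.CoFG]
    exact (Submodule.quotientEquivOfIsCompl _ _ hc.symm).symm.finiteDimensional
  have : u.range.CoFG := by
    rw [Submodule.CoFG]; infer_instance
  refine .of_isInvertible_restrict hX₁ hcl hmaps ?_
  have hi : Function.Injective (u.restrict hmaps) := by
    intro x y hxy
    exact LinearMap.ker_eq_bot.1 hinj (congrArg Subtype.val hxy)
  have hs : Function.Surjective (u.restrict hmaps) := by
    rintro ⟨y, hy⟩
    rw [← hrange] at hy
    obtain ⟨x, hx⟩ := hy
    exact ⟨x, Subtype.ext hx⟩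
  exact ⟨ContinuousLinearEquiv.ofBijective _ (LinearMap.ker_eq_bot.2 hi)
    (LinearMap.range_eq_top.2 hs), by ext; simp⟩

/-- The index count: if `F₁` becomes bijective after adding finitely many conditions `ι` with values
in a space of dimension `dim Z + dim Y₂`, and `C` is onto `Z`, then `(F₁, F₂)` restricted to `ker C`
has index `0`. Both its kernel and its cokernel are those of the map `(C, F₂)` between the spaces
`ker F₁` and `Z × Y₂` of equal finite dimension. -/
theorem isFredholmOfIndexZero_prod_comp_subtypeL {X Y₁ Y₂ Z Q : Type*}
    [NormedAddCommGroup X] [NormedSpace ℝ X] [CompleteSpace X]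
    [NormedAddCommGroup Y₁] [NormedSpace ℝ Y₁] [CompleteSpace Y₁]
    [NormedAddCommGroup Y₂] [NormedSpace ℝ Y₂] [FiniteDimensional ℝ Y₂]
    [NormedAddCommGroup Z] [NormedSpace ℝ Z] [FiniteDimensional ℝ Z]
    [AddCommGroup Q] [Module ℝ Q] [FiniteDimensional ℝ Q]
    (F : X →L[ℝ] Y₁ × Y₂) (ι : X →ₗ[ℝ] Q) (C : X →L[ℝ] Z)
    (hF : Function.Bijective fun x => ((F x).1, ι x)) (hC : Function.Surjective C)
    (hdim : Module.finrank ℝ Q = Module.finrank ℝ Z + Module.finrank ℝ Y₂) :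
    IsFredholmOfIndexZero (F.comp C.ker.subtypeL) := by
  let F₁ : X →ₗ[ℝ] Y₁ := (LinearMap.fst ℝ Y₁ Y₂).comp F.toLinearMap
  have hF₁s : Function.Surjective F₁ := fun y => by
    obtain ⟨x, hx⟩ := hF.2 (y, 0)
    exact ⟨x, congrArg Prod.fst hx⟩
  let e : F₁.ker ≃ₗ[ℝ] Q := LinearEquiv.ofBijective (ι.comp F₁.ker.subtype) (by
    constructor
    · intro x y hxy
      have hx : F₁ x = 0 := x.2
      have hy : F₁ y = 0 := y.2
      exact Subtype.ext (hF.1 (Prod.ext (hx.trans hy.symm) hxy))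
    · intro q
      obtain ⟨x, hx⟩ := hF.2 (0, q)
      exact ⟨⟨x, congrArg Prod.fst hx⟩, congrArg Prod.snd hx⟩)
  have hfd : FiniteDimensional ℝ F₁.ker := e.symm.finiteDimensional
  -- `G` is the map `(C, F₂)` on `ker F₁`.
  let G : F₁.ker →ₗ[ℝ] Z × Y₂ :=
    (C.toLinearMap.prod ((LinearMap.snd ℝ Y₁ Y₂).comp F.toLinearMap)).comp F₁.ker.subtype
  have hGdim : Module.finrank ℝ G.ker = Module.finrank ℝ ((Z × Y₂) ⧸ G.range) := by
    have h1 := G.finrank_range_add_finrank_ker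
    have h2 := G.range.finrank_quotient_add_finrank
    rw [e.finrank_eq, hdim] at h1
    rw [Module.finrank_prod] at h2
    omega
  set u := F.comp C.ker.subtypeL
  let eker : u.ker ≃ₗ[ℝ] G.ker :=
    { toFun := fun x => ⟨⟨x.1.1, (Prod.ext_iff.1 (show F x.1.1 = 0 from x.2)).1⟩,
        Prod.ext (show C x.1.1 = 0 from x.1.2) (Prod.ext_iff.1 (show F x.1.1 = 0 from x.2)).2⟩
      invFun := fun x => ⟨⟨x.1.1, (Prod.ext_iff.1 (show G x.1 = 0 from x.2)).1⟩,
        Prod.ext (show F₁ x.1.1 = 0 from x.1.2) (Prod.ext_iff.1 (show G x.1 = 0 from x.2)).2⟩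
      map_add' := fun _ _ => rfl
      map_smul' := fun _ _ => rfl
      left_inv := fun _ => rfl
      right_inv := fun _ => rfl }
  -- The cokernels are both compared with the cokernel of `(F₁, C, F₂)`.
  let S : X →ₗ[ℝ] Y₁ × Z × Y₂ :=
    F₁.prod (C.toLinearMap.prod ((LinearMap.snd ℝ Y₁ Y₂).comp F.toLinearMap))
  let j₁ : Z × Y₂ →ₗ[ℝ] (Y₁ × Z × Y₂) ⧸ S.range :=
    S.range.mkQ.comp (LinearMap.inr ℝ Y₁ (Z × Y₂))
  let j₂ : Y₁ × Y₂ →ₗ[ℝ] (Y₁ × Z × Y₂) ⧸ S.range :=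
    S.range.mkQ.comp (LinearMap.prodMap LinearMap.id (LinearMap.inr ℝ Z Y₂))
  have hj₁ : j₁.ker = G.range := by
    ext ⟨z, y⟩
    simp only [j₁, LinearMap.mem_ker, LinearMap.comp_apply, Submodule.mkQ_apply,
      Submodule.Quotient.mk_eq_zero, LinearMap.mem_range]
    constructor
    · rintro ⟨x, hx⟩
      exact ⟨⟨x, congrArg Prod.fst hx⟩, congrArg Prod.snd hx⟩
    · rintro ⟨x, hx⟩
      exact ⟨x.1, Prod.ext x.2 hx⟩
  have hj₂ : j₂.ker = u.range := by
    ext ⟨y₁, y₂⟩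
    simp only [j₂, LinearMap.mem_ker, LinearMap.comp_apply, Submodule.mkQ_apply,
      Submodule.Quotient.mk_eq_zero, LinearMap.mem_range]
    constructor
    · rintro ⟨x, hx⟩
      have h2 := Prod.ext_iff.1 (Prod.ext_iff.1 hx).2
      exact ⟨⟨x, h2.1⟩, Prod.ext (Prod.ext_iff.1 hx).1 h2.2⟩
    · rintro ⟨x, hx⟩
      exact ⟨x.1, Prod.ext (Prod.ext_iff.1 hx).1
        (Prod.ext (show C x.1 = 0 from x.2) (Prod.ext_iff.1 hx).2)⟩
  have hj₁s : Function.Surjective j₁ := by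
    intro q
    obtain ⟨⟨y, z, w⟩, rfl⟩ := S.range.mkQ_surjective q
    obtain ⟨x, rfl⟩ := hF₁s y
    refine ⟨(z - C x, w - (F x).2), ?_⟩
    simp only [j₁, LinearMap.comp_apply, Submodule.mkQ_apply]
    refine (Submodule.Quotient.eq _).2 ⟨-x, ?_⟩
    simp [S, F₁]
  have hj₂s : Function.Surjective j₂ := by
    intro q
    obtain ⟨⟨y, z, w⟩, rfl⟩ := S.range.mkQ_surjective q
    obtain ⟨x, rfl⟩ := hC z
    refine ⟨(y - F₁ x, w - (F x).2), ?_⟩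
    simp only [j₂, LinearMap.comp_apply, Submodule.mkQ_apply]
    refine (Submodule.Quotient.eq _).2 ⟨-x, ?_⟩
    simp [S, F₁]
  let ecoker : ((Y₁ × Y₂) ⧸ u.range) ≃ₗ[ℝ] ((Z × Y₂) ⧸ G.range) :=
    (Submodule.quotEquivOfEq _ _ hj₂.symm).trans
      ((j₂.quotKerEquivOfSurjective hj₂s).trans
        ((j₁.quotKerEquivOfSurjective hj₁s).symm.trans (Submodule.quotEquivOfEq _ _ hj₁)))
  have : FiniteDimensional ℝ u.ker := eker.symm.finiteDimensional
  have : FiniteDimensional ℝ ((Y₁ × Y₂) ⧸ u.range) := ecoker.symm.finiteDimensional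
  have : CompleteSpace Y₂ := FiniteDimensional.complete ℝ Y₂
  have : CompleteSpace C.ker := C.isClosed_ker.completeSpace_coe
  refine ⟨u.isFredholm_of_finiteDimensional, ?_⟩
  rw [eker.finrank_eq, ecoker.finrank_eq, hGdim, sub_self]

/-! ### Volterra operators -/

/-- If some power of `a` has norm less than `1`, then `1 + a` is a factor of the invertible element
`1 - (-a)^n`. -/
theorem isUnit_one_add_of_norm_pow_lt_one {R : Type*} [NormedRing R] [CompleteSpace R] {a : R}
    {n : ℕ} (ha : ‖a ^ n‖ < 1) : IsUnit (1 + a) := by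
  have hlt : ‖(-a) ^ n‖ < 1 := by
    rcases Nat.even_or_odd n with h | h
    · rwa [h.neg_pow]
    · rwa [h.neg_pow, norm_neg]
  have hu : IsUnit (1 - (-a) ^ n) := isUnit_one_sub_of_norm_lt_one hlt
  have hcomm : Commute (1 - -a) (∑ i ∈ Finset.range n, (-a) ^ i) := by
    rw [Commute, SemiconjBy, mul_neg_geom_sum, geom_sum_mul_neg]
  rw [← mul_neg_geom_sum, hcomm.isUnit_mul_iff] at hu
  simpa using hu.1

/-- A Volterra operator `K` on `C([0,1], W)` is quasi-nilpotent: `‖K^n‖ ≤ c^n / n!`. Hence `1 + K`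
is invertible. -/
theorem isUnit_one_add_of_volterra {W : Type*} [NormedAddCommGroup W] [NormedSpace ℝ W]
    [CompleteSpace W] (K : C(unitInterval, W) →L[ℝ] C(unitInterval, W)) {c : ℝ} (hc : 0 ≤ c)
    (hK : ∀ (z : C(unitInterval, W)) (n : ℕ) (b : ℝ), (∀ t, ‖z t‖ ≤ b * (t : ℝ) ^ n) →
      ∀ t, ‖K z t‖ ≤ c * (b * (t : ℝ) ^ (n + 1) / (n + 1))) :
    IsUnit (1 + K) := by
  have hpow : ∀ (n : ℕ) (z : C(unitInterval, W)) (t : unitInterval),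
      ‖(K ^ n) z t‖ ≤ (c ^ n / n.factorial * ‖z‖) * (t : ℝ) ^ n := by
    intro n z
    induction n with
    | zero => intro t; simpa using z.norm_coe_le_norm t
    | succ n ih =>
      intro t
      have := hK _ n _ ih t
      rw [pow_succ', mul_apply_eq_comp]
      refine this.trans (le_of_eq ?_)
      rw [Nat.factorial_succ]
      push_cast
      have : (n.factorial : ℝ) ≠ 0 := by positivity
      field_simp
      ring
  have hnorm : ∀ n : ℕ, ‖K ^ n‖ ≤ c ^ n / n.factorial := by
    intro n
    refine ContinuousLinearMap.opNorm_le_bound _ (by positivity) fun z => ?_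
    refine (ContinuousMap.norm_le _ (by positivity)).2 fun t => (hpow n z t).trans ?_
    exact mul_le_of_le_one_right (by positivity) (pow_le_one₀ t.2.1 t.2.2)
  obtain ⟨n, hn⟩ := ((FloorSemiring.tendsto_pow_div_factorial_atTop c).eventually_lt_const
    one_pos).exists
  exact isUnit_one_add_of_norm_pow_lt_one (R := C(unitInterval, W) →L[ℝ] C(unitInterval, W))
    (a := K) (n := n) ((hnorm n).trans_lt hn)

/-! ### Superposition operators on continuous functions -/

/-- Pointwise application of a continuous family of linear maps, as a continuous linear map. -/
def clmPointwise {P W : Type*} [NormedAddCommGroup P] [NormedSpace ℝ P] [NormedAddCommGroup W]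
    [NormedSpace ℝ W] (M : C(unitInterval, P →L[ℝ] W)) :
    C(unitInterval, P) →L[ℝ] C(unitInterval, W) :=
  LinearMap.mkContinuous
    { toFun := fun h => ⟨fun t => M t (h t), M.continuous.clm_apply h.continuous⟩
      map_add' := fun x y => by ext t; simp
      map_smul' := fun c x => by ext t; simp } ‖M‖ fun h =>
    (ContinuousMap.norm_le _ (by positivity)).2 fun t =>
      ((M t).le_opNorm (h t)).trans (mul_le_mul (M.norm_coe_le_norm t) (h.norm_coe_le_norm t)
        (norm_nonneg _) ((norm_nonneg (M t)).trans (M.norm_coe_le_norm t)))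

@[simp] theorem clmPointwise_apply {P W : Type*} [NormedAddCommGroup P] [NormedSpace ℝ P]
    [NormedAddCommGroup W] [NormedSpace ℝ W] (M : C(unitInterval, P →L[ℝ] W))
    (h : C(unitInterval, P)) (t : unitInterval) : clmPointwise M h t = M t (h t) := rfl

/-- A `C¹` map `N` acts on continuous functions by a differentiable superposition operator `Φ`,
whose derivative at `x` is the pointwise application of `DN(x(t))`. The remainder is uniformly small
because `DN` is uniformly continuous near the compact range of `x`. -/
theorem hasFDerivAt_superposition {P W : Type*} [NormedAddCommGroup P] [NormedSpace ℝ P]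
    [NormedAddCommGroup W] [NormedSpace ℝ W] {N : P → W} {Ω : Set P} (hΩ : IsOpen Ω)
    (hN : ContDiffOn ℝ 1 N Ω) {x : C(unitInterval, P)} (hx : ∀ t, x t ∈ Ω)
    {Φ : C(unitInterval, P) → C(unitInterval, W)}
    (hΦ : ∀ y : C(unitInterval, P), (∀ t, y t ∈ Ω) → ∀ t, Φ y t = N (y t))
    {D : C(unitInterval, P) →L[ℝ] C(unitInterval, W)}
    (hD : ∀ h t, D h t = fderiv ℝ N (x t) (h t)) : HasFDerivAt Φ D x := by
  have hcpt : IsCompact (range x) := isCompact_range x.continuous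
  have hsub : range x ⊆ Ω := range_subset_iff.2 hx
  have hfd : ∀ y ∈ Ω, HasFDerivAt N (fderiv ℝ N y) y := fun y hy =>
    ((hN.contDiffAt (hΩ.mem_nhds hy)).differentiableAt (by norm_num)).hasFDerivAt
  have hcont : ContinuousOn (fderiv ℝ N) Ω := hN.continuousOn_fderiv_of_isOpen hΩ le_rfl
  obtain ⟨r, hr, hrΩ⟩ := hcpt.exists_thickening_subset_open hΩ hsub
  rw [hasFDerivAt_iff_isLittleO, Asymptotics.isLittleO_iff]
  intro ε hε
  have huc := hcpt.uniformContinuousAt_of_continuousAt (fderiv ℝ N)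
    (fun a ha => hcont.continuousAt (hΩ.mem_nhds (hsub ha))) (Metric.dist_mem_uniformity hε)
  obtain ⟨ρ, hρ, hρ'⟩ := Metric.mem_uniformity_dist.1 huc
  have hmin : 0 < min r ρ := lt_min hr hρ
  filter_upwards [Metric.ball_mem_nhds x hmin] with y hy
  have hball : ∀ t, ∀ p ∈ Metric.ball (x t) (min r ρ), p ∈ Ω := fun t p hp =>
    hrΩ (Metric.mem_thickening_iff.2 ⟨x t, mem_range_self t,
      (Metric.mem_ball.1 hp).trans_le (min_le_left _ _)⟩)
  have hyt : ∀ t, y t ∈ Metric.ball (x t) (min r ρ) := fun t =>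
    (ContinuousMap.dist_apply_le_dist t).trans_lt hy
  refine (ContinuousMap.norm_le _ (by positivity)).2 fun t => ?_
  have key := (convex_ball (x t) (min r ρ)).norm_image_sub_le_of_norm_hasFDerivWithin_le'
    (f := N) (f' := fderiv ℝ N) (φ := fderiv ℝ N (x t)) (C := ε)
    (fun p hp => (hfd p (hball t p hp)).hasFDerivWithinAt)
    (fun p hp => by
      have : dist (fderiv ℝ N (x t)) (fderiv ℝ N p) < ε :=
        hρ' (a := x t) (b := p)
          (by rw [dist_comm]; exact (Metric.mem_ball.1 hp).trans_le (min_le_right _ _))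
          (mem_range_self t)
      rw [← dist_eq_norm, dist_comm]; exact this.le)
    (Metric.mem_ball_self hmin) (hyt t)
  have e1 : (Φ y - Φ x - D (y - x)) t = N (y t) - N (x t) - fderiv ℝ N (x t) (y t - x t) := by
    simp only [ContinuousMap.sub_apply, hD, hΦ y (fun t => hball t _ (hyt t)) t, hΦ x hx t]
  rw [e1]
  refine key.trans (mul_le_mul_of_nonneg_left ?_ hε.le)
  exact (y - x).norm_coe_le_norm t

/-! ### Primitives and the space of `C²` paths -/

theorem extendI_coe {F : Type*} [TopologicalSpace F] (u : C(unitInterval, F)) (t : unitInterval) :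
    extendI u t = u t := IccExtend_val _ _ _

theorem extendI_of_mem {F : Type*} [TopologicalSpace F] (u : C(unitInterval, F)) {t : ℝ}
    (ht : t ∈ Icc (0 : ℝ) 1) : extendI u t = u ⟨t, ht⟩ := IccExtend_of_mem _ _ _

theorem continuous_extendI {F : Type*} [TopologicalSpace F] (u : C(unitInterval, F)) :
    Continuous (extendI u) := u.continuous.Icc_extend'

/-- The primitive vanishing at `0`, as an operator on continuous functions on `[0,1]`. -/
def primitive (W : Type*) [NormedAddCommGroup W] [NormedSpace ℝ W] [CompleteSpace W] :
    C(unitInterval, W) →L[ℝ] C(unitInterval, W) :=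
  LinearMap.mkContinuous
    { toFun := fun z => ⟨fun t => ∫ s in (0 : ℝ)..t, extendI z s,
        (intervalIntegral.continuous_primitive
          (fun _ _ => (continuous_extendI z).intervalIntegrable _ _) 0).comp continuous_subtype_val⟩
      map_add' := fun x y => by
        ext t
        exact intervalIntegral.integral_add ((continuous_extendI x).intervalIntegrable _ _)
          ((continuous_extendI y).intervalIntegrable _ _)
      map_smul' := fun c x => by
        ext t
        exact intervalIntegral.integral_smul c (extendI x) } 1 fun z => by
    refine (ContinuousMap.norm_le _ (by positivity)).2 fun t => ?_
    have := intervalIntegral.norm_integral_le_of_norm_le_const (a := 0) (b := t) (C := ‖z‖)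
      (f := extendI z) fun s _ => z.norm_coe_le_norm _
    refine this.trans ?_
    rw [sub_zero, abs_of_nonneg t.2.1, one_mul]
    exact mul_le_of_le_one_right (norm_nonneg _) t.2.2

theorem primitive_apply {W : Type*} [NormedAddCommGroup W] [NormedSpace ℝ W] [CompleteSpace W]
    (z : C(unitInterval, W)) (t : unitInterval) :
    primitive W z t = ∫ s in (0 : ℝ)..t, extendI z s := rfl

theorem primitive_zero {W : Type*} [NormedAddCommGroup W] [NormedSpace ℝ W] [CompleteSpace W]
    (z : C(unitInterval, W)) : primitive W z 0 = 0 := by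
  simp [primitive_apply]

/-- Taking primitives raises the order of vanishing at `0` by one. -/
theorem norm_primitive_le {W : Type*} [NormedAddCommGroup W] [NormedSpace ℝ W] [CompleteSpace W]
    {z : C(unitInterval, W)} {b : ℝ} {n : ℕ} (h : ∀ t, ‖z t‖ ≤ b * (t : ℝ) ^ n)
    (t : unitInterval) : ‖primitive W z t‖ ≤ b * (t : ℝ) ^ (n + 1) / (n + 1) := by
  have key := intervalIntegral.norm_integral_le_of_norm_le (μ := MeasureTheory.volume)
    (f := extendI z) (g := fun s => b * s ^ n) t.2.1
    (Filter.Eventually.of_forall fun s hs => by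
      rw [extendI_of_mem z ⟨hs.1.le, hs.2.trans t.2.2⟩]
      exact h _) ((by fun_prop : Continuous fun s : ℝ => b * s ^ n).intervalIntegrable _ _)
  refine key.trans (le_of_eq ?_)
  rw [intervalIntegral.integral_const_mul, integral_pow]
  simp [mul_div_assoc]

/-- The fundamental theorem of calculus on `[0,1]`. -/
theorem hasDerivWithinAt_extendI_iff {W : Type*} [NormedAddCommGroup W] [NormedSpace ℝ W]
    [CompleteSpace W] (u v : C(unitInterval, W)) :
    (∀ t : unitInterval, HasDerivWithinAt (extendI u) (v t) (Icc 0 1) t) ↔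
      ∀ t, u t = u 0 + primitive W v t := by
  constructor
  · intro h t
    have := intervalIntegral.integral_eq_sub_of_hasDeriv_right_of_le (f := extendI u)
      (f' := extendI v) t.2.1 (continuous_extendI u).continuousOn (fun s hs => by
        have hs' : s ∈ Ioo (0 : ℝ) 1 := ⟨hs.1, hs.2.trans_le t.2.2⟩
        have := h ⟨s, Ioo_subset_Icc_self hs'⟩
        rw [extendI_of_mem v (Ioo_subset_Icc_self hs')]
        exact (this.hasDerivAt (Icc_mem_nhds hs'.1 hs'.2)).hasDerivWithinAt)
      ((continuous_extendI v).intervalIntegrable _ _)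
    rw [primitive_apply, this, extendI_coe, show (0 : ℝ) = ((0 : unitInterval) : ℝ) from rfl,
      extendI_coe]
    simp
  · intro h t
    have h1 : HasDerivAt (fun s => u 0 + ∫ x in (0 : ℝ)..s, extendI v x) (v t) t := by
      have := ((continuous_extendI v).integral_hasStrictDerivAt 0 t).hasDerivAt
      rw [extendI_coe] at this
      exact this.const_add _
    refine h1.hasDerivWithinAt.congr (fun s hs => ?_) ?_
    · rw [extendI_of_mem u hs, h, primitive_apply]
    · rw [extendI_coe, h, primitive_apply]

/-- Constant functions, as a continuous linear map. -/
def constC (W : Type*) [NormedAddCommGroup W] [NormedSpace ℝ W] : W →L[ℝ] C(unitInterval, W) :=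
  LinearMap.mkContinuous
    { toFun := fun w => .const _ w
      map_add' := fun _ _ => rfl
      map_smul' := fun _ _ => rfl } 1 fun w => by
    refine (ContinuousMap.norm_le _ (by positivity)).2 fun t => ?_
    rw [one_mul]
    exact le_rfl

@[simp] theorem constC_apply {W : Type*} [NormedAddCommGroup W] [NormedSpace ℝ W] (w : W)
    (t : unitInterval) : constC W w t = w := rfl

theorem mem_C2Submodule_iff {m : ℕ}
    (p : C(unitInterval, Euc m) × C(unitInterval, Euc m) × C(unitInterval, Euc m)) :
    p ∈ C2Submodule m ↔ (∀ t, p.1 t = p.1 0 + primitive _ p.2.1 t) ∧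
      ∀ t, p.2.1 t = p.2.1 0 + primitive _ p.2.2 t := by
  rw [← hasDerivWithinAt_extendI_iff, ← hasDerivWithinAt_extendI_iff, ← forall_and]
  rfl

theorem isClosed_C2Submodule (m : ℕ) : IsClosed (C2Submodule m : Set
    (C(unitInterval, Euc m) × C(unitInterval, Euc m) × C(unitInterval, Euc m))) := by
  have : (C2Submodule m : Set
      (C(unitInterval, Euc m) × C(unitInterval, Euc m) × C(unitInterval, Euc m))) =
      {p | ∀ t, p.1 t = p.1 0 + primitive _ p.2.1 t} ∩
        {p | ∀ t, p.2.1 t = p.2.1 0 + primitive _ p.2.2 t} := by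
    ext p
    exact mem_C2Submodule_iff p
  rw [this]
  have hp : Continuous (primitive (Euc m)) := (primitive (Euc m)).continuous
  have he : ∀ t, Continuous fun z : C(unitInterval, Euc m) => z t := fun t =>
    (ContinuousMap.evalCLM ℝ t).continuous
  simp only [ofPred_forall]
  refine (isClosed_iInter fun t => isClosed_eq ?_ ?_).inter
    (isClosed_iInter fun t => isClosed_eq ?_ ?_)
  · exact (he t).comp continuous_fst
  · exact ((he 0).comp continuous_fst).add
      ((he t).comp (hp.comp (continuous_fst.comp continuous_snd)))
  · exact (he t).comp (continuous_fst.comp continuous_snd)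
  · exact ((he 0).comp (continuous_fst.comp continuous_snd)).add
      ((he t).comp (hp.comp (continuous_snd.comp continuous_snd)))

instance (m : ℕ) : CompleteSpace (C2Path m) :=
  (isClosed_C2Submodule m).completeSpace_coe

namespace C2Path

variable {m : ℕ}

/-- The triple `(u, u', u'')` of a `C²` path. -/
def jet (m : ℕ) :
    C2Path m →L[ℝ] C(unitInterval, Euc m) × C(unitInterval, Euc m) × C(unitInterval, Euc m) :=
  (C2Submodule m).subtypeL

theorem jet_injective : Function.Injective (jet m) := Subtype.val_injective

theorem jet_mem (u : C2Path m) : jet m u ∈ C2Submodule m := u.2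

theorem pathVal_eq (u : C2Path m) (t : ℝ) : pathVal u t = extendI (jet m u).1 t := rfl

theorem pathDer_eq (u : C2Path m) (t : ℝ) : pathDer u t = extendI (jet m u).2.1 t := rfl

theorem norm_pathVal_le (u : C2Path m) (t : ℝ) : ‖pathVal u t‖ ≤ ‖u‖ :=
  ((jet m u).1.norm_coe_le_norm _).trans (norm_fst_le (jet m u))

theorem hasDerivWithinAt_pathVal (u : C2Path m) {t : ℝ} (ht : t ∈ Icc (0 : ℝ) 1) :
    HasDerivWithinAt (pathVal u) (pathDer u t) (Icc 0 1) t := by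
  have := (jet_mem u ⟨t, ht⟩).1
  rw [← extendI_of_mem (jet m u).2.1 ht] at this
  exact this

theorem hasDerivWithinAt_pathDer (u : C2Path m) {t : ℝ} (ht : t ∈ Icc (0 : ℝ) 1) :
    HasDerivWithinAt (pathDer u) (extendI (jet m u).2.2 t) (Icc 0 1) t := by
  have := (jet_mem u ⟨t, ht⟩).2
  rw [← extendI_of_mem (jet m u).2.2 ht] at this
  exact this

theorem fst_jet_eq (u : C2Path m) (t : unitInterval) :
    (jet m u).1 t = pathVal u 0 + primitive _ (jet m u).2.1 t := by
  have := ((mem_C2Submodule_iff _).1 (jet_mem u)).1 t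
  rwa [← extendI_coe _ 0] at this

theorem snd_jet_eq (u : C2Path m) (t : unitInterval) :
    (jet m u).2.1 t = pathDer u 0 + primitive _ (jet m u).2.2 t := by
  have := ((mem_C2Submodule_iff _).1 (jet_mem u)).2 t
  rwa [← extendI_coe _ 0] at this

/-- Evaluation at a time `t`, as a continuous linear map on `C²` paths. -/
def evalL (m : ℕ) (t : ℝ) : C2Path m →L[ℝ] Euc m :=
  (ContinuousMap.evalCLM ℝ (projIcc 0 1 zero_le_one t)).comp
    ((ContinuousLinearMap.fst ℝ _ _).comp (jet m))

/-- Evaluation of the derivative at a time `t`, as a continuous linear map on `C²` paths. -/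
def evalDerL (m : ℕ) (t : ℝ) : C2Path m →L[ℝ] Euc m :=
  (ContinuousMap.evalCLM ℝ (projIcc 0 1 zero_le_one t)).comp
    ((ContinuousLinearMap.fst ℝ _ _).comp ((ContinuousLinearMap.snd ℝ _ _).comp (jet m)))

/-- A `C²` path is given by its second derivative and its initial data. -/
theorem exists_jet_eq (z : C(unitInterval, Euc m)) (x₀ x₁ : Euc m) :
    ∃ u : C2Path m, (jet m u).2.2 = z ∧ pathVal u 0 = x₀ ∧ pathDer u 0 = x₁ ∧
      (∀ t, (jet m u).2.1 t = x₁ + primitive _ z t) ∧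
      ∀ t : unitInterval, (jet m u).1 t =
        x₀ + (t : ℝ) • x₁ + primitive _ (primitive _ z) t := by
  let v : C(unitInterval, Euc m) := constC _ x₁ + primitive _ z
  let w : C(unitInterval, Euc m) := constC _ x₀ + primitive _ v
  have hv0 : v 0 = x₁ := by simp [v, primitive_zero]
  have hw0 : w 0 = x₀ := by simp [w, primitive_zero]
  have hmem : (w, v, z) ∈ C2Submodule m := (mem_C2Submodule_iff _).2
    ⟨fun t => by rw [hw0]; rfl, fun t => by rw [hv0]; rfl⟩
  refine ⟨(⟨(w, v, z), hmem⟩ : C2Submodule m), rfl, ?_, ?_, fun t => rfl, fun t => ?_⟩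
  · exact (extendI_coe w 0).trans hw0
  · exact (extendI_coe v 0).trans hv0
  · change w t = _
    simp only [w, v, map_add, ContinuousMap.add_apply, constC_apply, ← add_assoc]
    congr 2
    rw [primitive_apply]
    have : extendI (constC (Euc m) x₁) = fun _ => x₁ := rfl
    rw [this]
    simp

end C2Path

/-! ### Linear second-order equations on `[0,1]` -/

/-- The space of the `(t, a, b, x, w)` on which the Lagrangian of an edge is defined. -/
abbrev LagrSpace (m : ℕ) : Type := ℝ × ℝ × ℝ × Euc m × Euc m

namespace LagrSpace

/-- The inclusion of the parameters `(a, b)`. -/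
def inParam (m : ℕ) : ℝ × ℝ →L[ℝ] LagrSpace m :=
  ((0 : ℝ × ℝ →L[ℝ] ℝ).prod ((ContinuousLinearMap.fst ℝ ℝ ℝ).prod
    ((ContinuousLinearMap.snd ℝ ℝ ℝ).prod 0)))

/-- The inclusion of the position `x`. -/
def inPos (m : ℕ) : Euc m →L[ℝ] LagrSpace m :=
  (0 : Euc m →L[ℝ] ℝ).prod ((0 : Euc m →L[ℝ] ℝ).prod ((0 : Euc m →L[ℝ] ℝ).prod
    ((ContinuousLinearMap.id ℝ _).prod 0)))

/-- The inclusion of the velocity `w`. -/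
def inVel (m : ℕ) : Euc m →L[ℝ] LagrSpace m :=
  (0 : Euc m →L[ℝ] ℝ).prod ((0 : Euc m →L[ℝ] ℝ).prod ((0 : Euc m →L[ℝ] ℝ).prod
    ((0 : Euc m →L[ℝ] Euc m).prod (ContinuousLinearMap.id ℝ _))))

theorem inParam_apply {m : ℕ} (c : ℝ × ℝ) : inParam m c = (0, c.1, c.2, 0, 0) := rfl

theorem inPos_apply {m : ℕ} (x : Euc m) : inPos m x = (0, 0, 0, x, 0) := rfl

theorem inVel_apply {m : ℕ} (w : Euc m) : inVel m w = (0, 0, 0, 0, w) := rfl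

end LagrSpace

/-- The linear part `t ↦ ((0, α, β, X(t), X'(t)), X''(t))` of the curve of second-order data of an
edge. -/
def edgeJet (m : ℕ) : (ℝ × ℝ × C2Path m) →L[ℝ] C(unitInterval, LagrSpace m × Euc m) :=
  let J := (C2Path.jet m).comp
    ((ContinuousLinearMap.snd ℝ _ _).comp (ContinuousLinearMap.snd ℝ ℝ _))
  let inl := ContinuousLinearMap.inl ℝ (LagrSpace m) (Euc m)
  let inr := ContinuousLinearMap.inr ℝ (LagrSpace m) (Euc m)
  (constC _).comp ((inl.comp (LagrSpace.inParam m)).comp ((ContinuousLinearMap.fst ℝ _ _).prod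
      ((ContinuousLinearMap.fst ℝ _ _).comp (ContinuousLinearMap.snd ℝ _ _)))) +
    ((inl.comp (LagrSpace.inPos m)).compLeftContinuous ℝ unitInterval).comp
      ((ContinuousLinearMap.fst ℝ _ _).comp J) +
    ((inl.comp (LagrSpace.inVel m)).compLeftContinuous ℝ unitInterval).comp
      ((ContinuousLinearMap.fst ℝ _ _).comp ((ContinuousLinearMap.snd ℝ _ _).comp J)) +
    (inr.compLeftContinuous ℝ unitInterval).comp
      ((ContinuousLinearMap.snd ℝ _ _).comp ((ContinuousLinearMap.snd ℝ _ _).comp J))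

theorem edgeJet_apply {m : ℕ} (q : ℝ × ℝ × C2Path m) (t : unitInterval) :
    edgeJet m q t = ((0, q.1, q.2.1, (C2Path.jet m q.2.2).1 t,
        (C2Path.jet m q.2.2).2.1 t), (C2Path.jet m q.2.2).2.2 t) := by
  have h : edgeJet m q t = (LagrSpace.inParam m (q.1, q.2.1), 0) +
      (LagrSpace.inPos m ((C2Path.jet m q.2.2).1 t), 0) +
      (LagrSpace.inVel m ((C2Path.jet m q.2.2).2.1 t), 0) + (0, (C2Path.jet m q.2.2).2.2 t) := rfl
  rw [h]
  simp [LagrSpace.inParam_apply, LagrSpace.inPos_apply, LagrSpace.inVel_apply]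

/-- The initial data of the linear second-order equation of an edge. -/
def edgeInit (m : ℕ) : (ℝ × ℝ × C2Path m) →ₗ[ℝ] ℝ × ℝ × Euc m × Euc m where
  toFun q := (q.1, q.2.1, C2Path.evalL m 0 q.2.2, C2Path.evalDerL m 0 q.2.2)
  map_add' x y := by simp
  map_smul' c x := by simp

/-- Unique solvability of the initial value problem for a linear second-order equation on `[0,1]`
with continuous coefficients and invertible leading coefficient. In terms of `z = X''` it becomes
the equation `(1 + K) z = r` with a Volterra operator `K`. -/
theorem bijective_edgeJet_edgeInit {m : ℕ}
    (M : C(unitInterval, (LagrSpace m × Euc m) →L[ℝ] Euc m))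
    (hM : ∀ t (ζ : Euc m), M t (0, ζ) = 0 → ζ = 0) :
    Function.Bijective fun q => (clmPointwise M (edgeJet m q), edgeInit m q) := by
  let Λ : unitInterval → Euc m →L[ℝ] Euc m := fun t =>
    (M t).comp (ContinuousLinearMap.inr ℝ (LagrSpace m) (Euc m))
  have hΛ : ∀ t, (Λ t).IsInvertible := fun t => by
    have hi : Function.Injective (Λ t) := (injective_iff_map_eq_zero _).2 fun ζ => hM t ζ
    exact ⟨(LinearEquiv.ofInjectiveEndo (Λ t).toLinearMap hi).toContinuousLinearEquiv, by
      ext; rfl⟩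
  have hΛc : Continuous Λ := M.continuous.clm_comp continuous_const
  let N : C(unitInterval, Euc m →L[ℝ] Euc m) := ⟨fun t => (Λ t).inverse,
    continuous_iff_continuousAt.2 fun t =>
      ((hΛ t).contDiffAt_map_inverse (n := 0)).continuousAt.comp hΛc.continuousAt⟩
  have hNΛ : ∀ t ζ, N t (M t (0, ζ)) = ζ := fun t ζ =>
    DFunLike.congr_fun (hΛ t).inverse_comp_self ζ
  have hΛN : ∀ t ζ, M t (0, N t ζ) = ζ := fun t ζ =>
    DFunLike.congr_fun (hΛ t).self_comp_inverse ζ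
  let P := primitive (Euc m)
  -- `M₁` and `M₂` are the coefficients of `X` and `X'` after division by the leading coefficient.
  let i₁ := (ContinuousLinearMap.inl ℝ (LagrSpace m) (Euc m)).comp (LagrSpace.inPos m)
  let i₂ := (ContinuousLinearMap.inl ℝ (LagrSpace m) (Euc m)).comp (LagrSpace.inVel m)
  let M₁ : C(unitInterval, Euc m →L[ℝ] Euc m) :=
    ⟨fun t => (N t).comp ((M t).comp i₁), by fun_prop⟩
  let M₂ : C(unitInterval, Euc m →L[ℝ] Euc m) :=
    ⟨fun t => (N t).comp ((M t).comp i₂), by fun_prop⟩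
  let K : C(unitInterval, Euc m) →L[ℝ] C(unitInterval, Euc m) :=
    (clmPointwise M₁).comp (P.comp P) + (clmPointwise M₂).comp P
  have hK : ∀ z t, K z t = N t (M t ((0, 0, 0, P (P z) t, P z t), 0)) := by
    intro z t
    have : (((0, 0, 0, P (P z) t, P z t), 0) : LagrSpace m × Euc m) =
        i₁ (P (P z) t) + i₂ (P z t) := by
      simp [i₁, i₂, LagrSpace.inPos_apply, LagrSpace.inVel_apply]
    rw [this, map_add, map_add]
    rfl
  have hunit : IsUnit (1 + K) := by
    have hn : ∀ M' : C(unitInterval, Euc m →L[ℝ] Euc m), 0 ≤ ‖M'‖ := fun M' =>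
      (norm_nonneg (M' 0)).trans (M'.norm_coe_le_norm 0)
    refine isUnit_one_add_of_volterra K (add_nonneg (hn M₁) (hn M₂)) fun z n b hz t => ?_
    have hb : 0 ≤ b := by simpa using (norm_nonneg _).trans (hz 1)
    have h1 : ∀ t : unitInterval, ‖P z t‖ ≤ b * (t : ℝ) ^ (n + 1) / (n + 1) :=
      norm_primitive_le hz
    have h2 : ‖P (P z) t‖ ≤ b * (t : ℝ) ^ (n + 1) / (n + 1) := by
      have := norm_primitive_le (z := P z) (b := b / (n + 1)) (n := n + 1)
        (fun s => (h1 s).trans (le_of_eq (by ring))) t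
      refine this.trans ?_
      have ht0 : (0 : ℝ) ≤ t := t.2.1
      calc b / (n + 1) * (t : ℝ) ^ (n + 1 + 1) / ((n + 1 : ℕ) + 1)
          ≤ b / (n + 1) * (t : ℝ) ^ (n + 1 + 1) := by
            refine div_le_self (by positivity) ?_
            push_cast
            linarith [(n.cast_nonneg : (0 : ℝ) ≤ n)]
        _ ≤ b / (n + 1) * (t : ℝ) ^ (n + 1) := by
            refine mul_le_mul_of_nonneg_left ?_ (by positivity)
            exact pow_le_pow_of_le_one ht0 t.2.2 (Nat.le_succ _)
        _ = _ := by ring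
    calc ‖K z t‖ ≤ ‖M₁ t (P (P z) t)‖ + ‖M₂ t (P z t)‖ := norm_add_le _ _
      _ ≤ ‖M₁‖ * (b * (t : ℝ) ^ (n + 1) / (n + 1)) +
          ‖M₂‖ * (b * (t : ℝ) ^ (n + 1) / (n + 1)) := by
        refine add_le_add (((M₁ t).le_opNorm _).trans ?_) (((M₂ t).le_opNorm _).trans ?_)
        · exact mul_le_mul (M₁.norm_coe_le_norm t) h2 (norm_nonneg _) (hn _)
        · exact mul_le_mul (M₂.norm_coe_le_norm t) (h1 t) (norm_nonneg _) (hn _)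
      _ = _ := by ring
  obtain ⟨S, hS⟩ := hunit
  have hlin : IsLinearMap ℝ fun q => (clmPointwise M (edgeJet m q), edgeInit m q) :=
    ⟨fun x y => by simp, fun c x => by simp⟩
  constructor
  · refine (injective_iff_map_eq_zero hlin.mk').2 ?_
    rintro ⟨α, β, X⟩ hq
    have hq1 : clmPointwise M (edgeJet m (α, β, X)) = 0 := congrArg Prod.fst hq
    have hq2 : edgeInit m (α, β, X) = 0 := congrArg Prod.snd hq
    obtain rfl : α = 0 := (Prod.ext_iff.1 hq2).1
    have hq3 := Prod.ext_iff.1 (Prod.ext_iff.1 hq2).2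
    obtain rfl : β = 0 := hq3.1
    have hX0 : pathVal X 0 = 0 := (Prod.ext_iff.1 hq3.2).1
    have hX1 : pathDer X 0 = 0 := (Prod.ext_iff.1 hq3.2).2
    have e2 : (C2Path.jet m X).2.1 = P (C2Path.jet m X).2.2 := by
      ext1 t
      rw [C2Path.snd_jet_eq, hX1, zero_add]
    have e1 : (C2Path.jet m X).1 = P (P (C2Path.jet m X).2.2) := by
      ext1 t
      rw [C2Path.fst_jet_eq, hX0, zero_add, e2]
    have hz : (1 + K) (C2Path.jet m X).2.2 = 0 := by
      ext1 t
      have h0 : M t (edgeJet m (0, 0, X) t) = 0 := DFunLike.congr_fun hq1 t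
      have hsplit : edgeJet m (0, 0, X) t =
          ((0, 0, 0, P (P (C2Path.jet m X).2.2) t, P (C2Path.jet m X).2.2 t), 0) +
            (0, (C2Path.jet m X).2.2 t) := by
        rw [edgeJet_apply, e1, e2]
        simp
      rw [hsplit, map_add] at h0
      have := congrArg (N t) h0
      rw [map_add, hNΛ, ← hK, map_zero] at this
      rw [add_comm] at this
      exact this
    have hz0 : (C2Path.jet m X).2.2 = 0 := by
      have := congrArg (fun f => (↑S⁻¹ : C(unitInterval, Euc m) →L[ℝ] C(unitInterval, Euc m)) f) hz
      simp only [← hS, map_zero] at this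
      rwa [← mul_apply_eq_comp, Units.inv_mul] at this
    have : C2Path.jet m X = 0 := by
      refine Prod.ext ?_ (Prod.ext ?_ hz0)
      · rw [e1, hz0, map_zero, map_zero]; rfl
      · rw [e2, hz0, map_zero]; rfl
    have hX : X = 0 := C2Path.jet_injective (this.trans (map_zero _).symm)
    rw [hX]
    rfl
  · rintro ⟨h, α, β, x₀, x₁⟩
    let r : C(unitInterval, Euc m) :=
      ⟨fun t => N t (h t - M t ((0, α, β, x₀ + (t : ℝ) • x₁, x₁), 0)), by fun_prop⟩
    let z := (↑S⁻¹ : C(unitInterval, Euc m) →L[ℝ] C(unitInterval, Euc m)) r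
    have hz : (1 + K) z = r := by
      rw [← hS, ← mul_apply_eq_comp, Units.mul_inv]
      rfl
    obtain ⟨X, hX2, hX0, hX1, hX', hX⟩ := C2Path.exists_jet_eq z x₀ x₁
    refine ⟨(α, β, X), Prod.ext ?_ ?_⟩
    · ext1 t
      change M t (edgeJet m (α, β, X) t) = h t
      have hsplit : edgeJet m (α, β, X) t = ((0, α, β, x₀ + (t : ℝ) • x₁, x₁), 0) +
          ((0, 0, 0, P (P z) t, P z t), 0) + (0, z t) := by
        rw [edgeJet_apply, hX, hX', hX2]
        simp [P]
      have hzt : z t + K z t = N t (h t - M t ((0, α, β, x₀ + (t : ℝ) • x₁, x₁), 0)) :=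
        DFunLike.congr_fun hz t
      have := congrArg (fun ζ => M t (0, ζ)) hzt
      simp only [hΛN] at this
      rw [show ((0, z t + K z t) : LagrSpace m × Euc m) = (0, z t) + (0, K z t) by simp, map_add,
        hK, hΛN] at this
      rw [hsplit, map_add, map_add, add_assoc, add_comm (M t ((0, 0, 0, _, _), 0)), this]
      abel
    · exact Prod.ext rfl (Prod.ext rfl (Prod.ext hX0 hX1))

/-! ### The Euler-Lagrange expression of a Lagrangian -/

/-- The Riesz representation of linear functionals by vectors, as a real linear map. -/
def dualToVec (m : ℕ) : (Euc m →L[ℝ] ℝ) →L[ℝ] Euc m :=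
  LinearMap.toContinuousLinearMap
    { toFun := fun f => (InnerProductSpace.toDual ℝ (Euc m)).symm f
      map_add' := fun f g => map_add _ f g
      map_smul' := fun c f => by simp }

theorem dualToVec_apply {m : ℕ} (f : Euc m →L[ℝ] ℝ) :
    dualToVec m f = (InnerProductSpace.toDual ℝ (Euc m)).symm f := rfl

theorem inner_dualToVec {m : ℕ} (f : Euc m →L[ℝ] ℝ) (y : Euc m) :
    inner ℝ (dualToVec m f) y = f y := by
  rw [dualToVec_apply, InnerProductSpace.toDual_symm_apply]

section Lagrangian

variable {m : ℕ}

/-- The partial gradient of a Lagrangian in the position. -/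
def gradPos (ℓ : LagrSpace m → ℝ) (q : LagrSpace m) : Euc m :=
  dualToVec m ((fderiv ℝ ℓ q).comp (LagrSpace.inPos m))

/-- The partial gradient of a Lagrangian in the velocity. -/
def gradVel (ℓ : LagrSpace m → ℝ) (q : LagrSpace m) : Euc m :=
  dualToVec m ((fderiv ℝ ℓ q).comp (LagrSpace.inVel m))

/-- The expression `c (∇_x ℓ - d/dt ∇_w ℓ)` along a curve `(t, a, b, x(t), x'(t))`, as a function of
the point of the curve and of `x''(t)`. -/
def eulerLagrangeMap (ℓ : LagrSpace m → ℝ) (c : ℝ) (p : LagrSpace m × Euc m) : Euc m :=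
  c • (gradPos ℓ p.1 - fderiv ℝ (gradVel ℓ) p.1 (1, 0, 0, p.1.2.2.2.2, p.2))

variable {ℓ : LagrSpace m → ℝ} {Ω : Set (LagrSpace m)}

theorem gradient_pos_eq {t a b : ℝ} {x w : Euc m} (h : DifferentiableAt ℝ ℓ (t, a, b, x, w)) :
    gradient (fun x => ℓ (t, a, b, x, w)) x = gradPos ℓ (t, a, b, x, w) := by
  have h1 : HasFDerivAt (fun x : Euc m => ((t, a, b, x, w) : LagrSpace m)) (LagrSpace.inPos m) x :=
    (hasFDerivAt_const t x).prodMk ((hasFDerivAt_const a x).prodMk ((hasFDerivAt_const b x).prodMk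
      ((hasFDerivAt_id x).prodMk (hasFDerivAt_const w x))))
  have h2 := h.hasFDerivAt.comp x h1
  rw [gradient]
  exact congrArg _ h2.fderiv

theorem gradient_vel_eq {t a b : ℝ} {x w : Euc m} (h : DifferentiableAt ℝ ℓ (t, a, b, x, w)) :
    gradient (fun w => ℓ (t, a, b, x, w)) w = gradVel ℓ (t, a, b, x, w) := by
  have h1 : HasFDerivAt (fun w : Euc m => ((t, a, b, x, w) : LagrSpace m)) (LagrSpace.inVel m) w :=
    (hasFDerivAt_const t w).prodMk ((hasFDerivAt_const a w).prodMk ((hasFDerivAt_const b w).prodMk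
      ((hasFDerivAt_const x w).prodMk (hasFDerivAt_id w))))
  have h2 := h.hasFDerivAt.comp w h1
  rw [gradient]
  exact congrArg _ h2.fderiv

theorem deriv_left_eq {t a b : ℝ} {x w : Euc m} (h : DifferentiableAt ℝ ℓ (t, a, b, x, w)) :
    deriv (fun a => ℓ (t, a, b, x, w)) a =
      fderiv ℝ ℓ (t, a, b, x, w) (LagrSpace.inParam m (1, 0)) := by
  have h1 : HasDerivAt (fun a : ℝ => ((t, a, b, x, w) : LagrSpace m))
      (LagrSpace.inParam m (1, 0)) a :=
    (hasDerivAt_const a t).prodMk ((hasDerivAt_id a).prodMk ((hasDerivAt_const a b).prodMk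
      ((hasDerivAt_const a x).prodMk (hasDerivAt_const a w))))
  exact (h.hasFDerivAt.comp_hasDerivAt a h1).deriv

theorem deriv_right_eq {t a b : ℝ} {x w : Euc m} (h : DifferentiableAt ℝ ℓ (t, a, b, x, w)) :
    deriv (fun b => ℓ (t, a, b, x, w)) b =
      fderiv ℝ ℓ (t, a, b, x, w) (LagrSpace.inParam m (0, 1)) := by
  have h1 : HasDerivAt (fun b : ℝ => ((t, a, b, x, w) : LagrSpace m))
      (LagrSpace.inParam m (0, 1)) b :=
    (hasDerivAt_const b t).prodMk ((hasDerivAt_const b a).prodMk ((hasDerivAt_id b).prodMk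
      ((hasDerivAt_const b x).prodMk (hasDerivAt_const b w))))
  exact (h.hasFDerivAt.comp_hasDerivAt b h1).deriv

theorem contDiffOn_fderiv_comp {V : Type*} [NormedAddCommGroup V] [NormedSpace ℝ V]
    (hΩ : IsOpen Ω) (hℓ : ContDiffOn ℝ 3 ℓ Ω) (i : V →L[ℝ] LagrSpace m) :
    ContDiffOn ℝ 2 (fun q => (fderiv ℝ ℓ q).comp i) Ω :=
  (hℓ.fderiv_of_isOpen hΩ (by norm_num)).clm_comp contDiffOn_const

theorem contDiffOn_gradPos (hΩ : IsOpen Ω) (hℓ : ContDiffOn ℝ 3 ℓ Ω) :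
    ContDiffOn ℝ 2 (gradPos ℓ) Ω :=
  (dualToVec m).contDiff.comp_contDiffOn (contDiffOn_fderiv_comp hΩ hℓ _)

theorem contDiffOn_gradVel (hΩ : IsOpen Ω) (hℓ : ContDiffOn ℝ 3 ℓ Ω) :
    ContDiffOn ℝ 2 (gradVel ℓ) Ω :=
  (dualToVec m).contDiff.comp_contDiffOn (contDiffOn_fderiv_comp hΩ hℓ _)

theorem contDiffOn_eulerLagrangeMap (hΩ : IsOpen Ω) (hℓ : ContDiffOn ℝ 3 ℓ Ω) (c : ℝ) :
    ContDiffOn ℝ 1 (eulerLagrangeMap ℓ c) (Ω ×ˢ univ) := by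
  have hf : MapsTo Prod.fst (Ω ×ˢ (univ : Set (Euc m))) Ω := fun p hp => hp.1
  have h1 : ContDiffOn ℝ 1 (fun p : LagrSpace m × Euc m => gradPos ℓ p.1) (Ω ×ˢ univ) :=
    ((contDiffOn_gradPos hΩ hℓ).of_le (by norm_num)).comp contDiff_fst.contDiffOn hf
  have h2 : ContDiffOn ℝ 1 (fun p : LagrSpace m × Euc m => fderiv ℝ (gradVel ℓ) p.1)
      (Ω ×ˢ univ) :=
    ((contDiffOn_gradVel hΩ hℓ).fderiv_of_isOpen hΩ (by norm_num)).comp contDiff_fst.contDiffOn hf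
  have h3 : ContDiff ℝ 1 (fun p : LagrSpace m × Euc m =>
      ((1, 0, 0, p.1.2.2.2.2, p.2) : LagrSpace m)) := by fun_prop
  exact (h1.sub (h2.clm_apply h3.contDiffOn)).const_smul c

/-- The coefficient of the second derivative in the linearized Euler-Lagrange expression is the
Hessian of the Lagrangian in the velocity, up to the factor `-c`. -/
theorem fderiv_eulerLagrangeMap_inr (hΩ : IsOpen Ω) (hℓ : ContDiffOn ℝ 3 ℓ Ω) (c : ℝ)
    {p : LagrSpace m × Euc m} (hp : p.1 ∈ Ω) (ζ : Euc m) :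
    fderiv ℝ (eulerLagrangeMap ℓ c) p (0, ζ) =
      -(c • fderiv ℝ (gradVel ℓ) p.1 (LagrSpace.inVel m ζ)) := by
  have hd : DifferentiableAt ℝ (eulerLagrangeMap ℓ c) p :=
    ((contDiffOn_eulerLagrangeMap hΩ hℓ c).contDiffAt
      ((hΩ.prod isOpen_univ).mem_nhds ⟨hp, trivial⟩)).differentiableAt (by norm_num)
  have h1 : HasDerivAt (fun s : ℝ => p + s • ((0, ζ) : LagrSpace m × Euc m)) (0, ζ) 0 := by
    simpa using ((hasDerivAt_id (0 : ℝ)).smul_const ((0, ζ) : LagrSpace m × Euc m)).const_add p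
  have h2 : HasDerivAt (fun s : ℝ => eulerLagrangeMap ℓ c (p + s • ((0, ζ) : LagrSpace m × Euc m)))
      (fderiv ℝ (eulerLagrangeMap ℓ c) p (0, ζ)) 0 := by
    have h0 : DifferentiableAt ℝ (eulerLagrangeMap ℓ c)
      (p + (0 : ℝ) • ((0, ζ) : LagrSpace m × Euc m)) := by simpa using hd
    have h := h0.hasFDerivAt.comp_hasDerivAt 0 h1
    rw [zero_smul, add_zero] at h
    exact h
  have h3 : (fun s : ℝ => eulerLagrangeMap ℓ c (p + s • ((0, ζ) : LagrSpace m × Euc m))) =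
      fun s => eulerLagrangeMap ℓ c p +
        s • (-(c • fderiv ℝ (gradVel ℓ) p.1 (LagrSpace.inVel m ζ))) := by
    funext s
    have e : ((1, 0, 0, p.1.2.2.2.2, p.2 + s • ζ) : LagrSpace m) =
        (1, 0, 0, p.1.2.2.2.2, p.2) + s • LagrSpace.inVel m ζ := by
      simp [LagrSpace.inVel_apply]
    simp only [eulerLagrangeMap, Prod.fst_add, Prod.snd_add, Prod.smul_fst, Prod.smul_snd,
      smul_zero, add_zero]
    rw [e, map_add, map_smul]
    module
  rw [h3] at h2
  have h4 := ((hasDerivAt_id (0 : ℝ)).smul_const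
    (-(c • fderiv ℝ (gradVel ℓ) p.1 (LagrSpace.inVel m ζ)))).const_add (eulerLagrangeMap ℓ c p)
  simpa using h2.unique h4

/-- If `ℓ²` is the quadratic polynomial `α + 2βs + γs²` on a line in the direction of a velocity `ζ`
that the Hessian of `ℓ` in the velocity annihilates, then its discriminant vanishes: from
`ℓ ℓ' = β + γs` and `ℓ'' = 0` follows `ℓ'² = γ` at `s = 0`. -/
theorem sq_eq_mul_of_fderiv_gradVel_eq_zero (hΩ : IsOpen Ω) (hℓ : ContDiffOn ℝ 3 ℓ Ω)
    {q : LagrSpace m} (hq : q ∈ Ω) {ζ : Euc m} {α β γ : ℝ}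
    (hsq : ∀ s : ℝ, ℓ (q + s • LagrSpace.inVel m ζ) ^ 2 = α + 2 * β * s + γ * s ^ 2)
    (h : fderiv ℝ (gradVel ℓ) q (LagrSpace.inVel m ζ) = 0) : β ^ 2 = α * γ := by
  set L : ℝ → LagrSpace m := fun s => q + s • LagrSpace.inVel m ζ with hL
  have hL0 : L 0 = q := by simp [hL]
  have hLd : ∀ s, HasDerivAt L (LagrSpace.inVel m ζ) s := fun s => by
    have := ((hasDerivAt_id s).smul_const (LagrSpace.inVel m ζ)).const_add q
    rw [one_smul] at this
    exact this
  have hLΩ : ∀ᶠ s in 𝓝 (0 : ℝ), L s ∈ Ω :=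
    (hLd 0).continuousAt.eventually_mem (hΩ.mem_nhds (by rwa [hL0]))
  have hf : ∀ s, L s ∈ Ω →
      HasDerivAt (fun s => ℓ (L s)) (inner ℝ (gradVel ℓ (L s)) ζ) s := fun s hs => by
    rw [gradVel, inner_dualToVec]
    exact ((hℓ.contDiffAt (hΩ.mem_nhds hs)).differentiableAt
      (by norm_num)).hasFDerivAt.comp_hasDerivAt s (hLd s)
  have hpoly : ∀ s, HasDerivAt (fun s : ℝ => α + 2 * β * s + γ * s ^ 2) (2 * (β + γ * s)) s := by
    intro s
    have := (((hasDerivAt_id s).const_mul (2 * β)).const_add α).add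
      (((hasDerivAt_id s).pow 2).const_mul γ)
    convert! this using 1
    simp
    ring
  have hff : ∀ᶠ s in 𝓝 (0 : ℝ), ℓ (L s) * inner ℝ (gradVel ℓ (L s)) ζ = β + γ * s := by
    filter_upwards [hLΩ] with s hs
    have h1 := (hf s hs).pow 2
    have h2 : HasDerivAt (fun s => ℓ (L s) ^ 2) (2 * (β + γ * s)) s :=
      (hpoly s).congr_of_eventuallyEq (Filter.Eventually.of_forall hsq)
    have := h1.unique h2
    simp at this
    linarith
  have hG : HasDerivAt (fun s => inner ℝ (gradVel ℓ (L s)) ζ) (0 : ℝ) 0 := by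
    have hd : DifferentiableAt ℝ (gradVel ℓ) (L 0) := by
      rw [hL0]
      exact ((contDiffOn_gradVel hΩ hℓ).contDiffAt (hΩ.mem_nhds hq)).differentiableAt (by norm_num)
    have h1 := hd.hasFDerivAt.comp_hasDerivAt 0 (hLd 0)
    rw [hL0, h] at h1
    simpa using h1.inner ℝ (hasDerivAt_const (0 : ℝ) ζ)
  have h0 : L 0 ∈ Ω := by rwa [hL0]
  have hprod := (hf 0 h0).mul hG
  have hlin : HasDerivAt (fun s : ℝ => β + γ * s) γ 0 := by
    simpa using ((hasDerivAt_id (0 : ℝ)).const_mul γ).const_add β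
  have e1 := hprod.unique (hlin.congr_of_eventuallyEq hff)
  have e2 := hff.self_of_nhds
  have e3 := hsq 0
  change ℓ (L 0) ^ 2 = _ at e3
  simp only [mul_zero, add_zero, ne_eq, OfNat.ofNat_ne_zero, not_false_eq_true, zero_pow]
    at e1 e2 e3
  rw [← e1, ← e3, ← e2]
  ring

end Lagrangian

/-! ### Curves of second-order data -/

/-- The curve `t ↦ ((t, a, b, u(t), u'(t)), u''(t))` of second-order data of an edge. -/
def edgeCurve {m : ℕ} (c : ℝ × ℝ × C2Path m) : C(unitInterval, LagrSpace m × Euc m) :=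
  ⟨fun t => (((t : ℝ), 0, 0, 0, 0), 0), by fun_prop⟩ + edgeJet m c

theorem edgeCurve_apply {m : ℕ} (c : ℝ × ℝ × C2Path m) (t : unitInterval) :
    edgeCurve c t =
      (((t : ℝ), c.1, c.2.1, pathVal c.2.2 t, pathDer c.2.2 t), (C2Path.jet m c.2.2).2.2 t) := by
  have : edgeCurve c t = (((t : ℝ), 0, 0, 0, 0), 0) + edgeJet m c t := rfl
  rw [this, edgeJet_apply, C2Path.pathVal_eq, C2Path.pathDer_eq, extendI_coe, extendI_coe]
  simp

theorem hasFDerivAt_edgeCurve {m : ℕ} (c : ℝ × ℝ × C2Path m) :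
    HasFDerivAt edgeCurve (edgeJet m) c :=
  (edgeJet m).hasFDerivAt.const_add _

theorem toC0_apply {F : Type*} [TopologicalSpace F] [Zero F] {h : ℝ → F}
    (hc : ContinuousOn h (Icc 0 1)) (t : unitInterval) : toC0 h t = h t := by
  rw [toC0, dif_pos hc]
  rfl

/-- The superposition operator of a map `N` on continuous functions. -/
def superposition {P W : Type*} [TopologicalSpace P] [TopologicalSpace W] [Zero W] (N : P → W)
    (y : C(unitInterval, P)) : C(unitInterval, W) := toC0 fun t => N (extendI y t)

theorem superposition_apply {P W : Type*} [TopologicalSpace P] [TopologicalSpace W] [Zero W]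
    {N : P → W} {Ω : Set P} (hN : ContinuousOn N Ω) {y : C(unitInterval, P)} (hy : ∀ t, y t ∈ Ω)
    (t : unitInterval) : superposition N y t = N (y t) := by
  rw [superposition, toC0_apply, extendI_coe]
  exact hN.comp (continuous_extendI y).continuousOn fun s _ => hy _

/-- The derivative at a `C²` edge `c` of a `C¹` expression in the second-order data. -/
theorem hasFDerivAt_superposition_edgeCurve {m : ℕ} {W : Type*} [NormedAddCommGroup W]
    [NormedSpace ℝ W] {N : LagrSpace m × Euc m → W} {Ω : Set (LagrSpace m × Euc m)}
    (hΩ : IsOpen Ω) (hN : ContDiffOn ℝ 1 N Ω) {c : ℝ × ℝ × C2Path m}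
    (hc : ∀ t, edgeCurve c t ∈ Ω) {M : C(unitInterval, LagrSpace m × Euc m →L[ℝ] W)}
    (hM : ∀ t, M t = fderiv ℝ N (edgeCurve c t)) :
    HasFDerivAt (fun c => superposition N (edgeCurve c)) ((clmPointwise M).comp (edgeJet m)) c :=
  (hasFDerivAt_superposition hΩ hN hc
    (fun _ hy t => superposition_apply hN.continuousOn hy t)
    (D := clmPointwise M) fun h t => by rw [clmPointwise_apply, hM]).comp c
    (hasFDerivAt_edgeCurve c)

/-- The continuous family of the derivatives of a `C¹` map along a curve. -/
theorem exists_fderiv_along {P W : Type*} [NormedAddCommGroup P] [NormedSpace ℝ P]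
    [NormedAddCommGroup W] [NormedSpace ℝ W] {N : P → W} {Ω : Set P} (hΩ : IsOpen Ω)
    (hN : ContDiffOn ℝ 1 N Ω) {y : C(unitInterval, P)} (hy : ∀ t, y t ∈ Ω) :
    ∃ M : C(unitInterval, P →L[ℝ] W), ∀ t, M t = fderiv ℝ N (y t) :=
  ⟨⟨fun t => fderiv ℝ N (y t),
    (hN.continuousOn_fderiv_of_isOpen hΩ le_rfl).comp_continuous y.continuous hy⟩, fun _ => rfl⟩

/-- A function on `[0,1]` is continuous if it is a continuous expression in the points of a
curve. -/
theorem continuousOn_Icc_of_eq {P W : Type*} [TopologicalSpace P] [TopologicalSpace W]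
    {N : P → W} {Ω : Set P} (hN : ContinuousOn N Ω) {y : C(unitInterval, P)} (hy : ∀ t, y t ∈ Ω)
    {h : ℝ → W} (hh : ∀ t : unitInterval, h t = N (y t)) : ContinuousOn h (Icc 0 1) :=
  (hN.comp (continuous_extendI y).continuousOn fun s _ => hy (projIcc 0 1 zero_le_one s)).congr
    fun s hs => by
      rw [Function.comp_apply, extendI_of_mem y hs]
      exact hh ⟨s, hs⟩

/-! ### The Euclidean space of positions along and across an edge -/

/-- The Euclidean adjoint, as a real linear map. -/
def adjointL (m : ℕ) : (Rn m →L[ℝ] Rn m) →L[ℝ] (Rn m →L[ℝ] Rn m) :=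
  LinearMap.toContinuousLinearMap
    { toFun := fun T => T.adjoint
      map_add' := fun S T => map_add _ S T
      map_smul' := fun c T => by simp }

theorem finrank_Rn (m : ℕ) : Module.finrank ℝ (Rn m) = m + 1 := by
  rw [(WithLp.prodContinuousLinearEquiv 2 ℝ ℝ (Euc m)).toLinearEquiv.finrank_eq,
    Module.finrank_prod, finrank_euclideanSpace_fin, Module.finrank_self, add_comm]

/-! ### Metrics and tubular coordinates -/

theorem contMDiff_tangentBundle_mk (F : Type*) [NormedAddCommGroup F] [NormedSpace ℝ F]
    {n : WithTop ℕ∞} : ContMDiff 𝓘(ℝ, F × F) 𝓘(ℝ, F).tangent n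
      (fun p : F × F => (⟨p.1, p.2⟩ : TangentBundle 𝓘(ℝ, F) F)) := by
  intro p
  rw [Bundle.contMDiffAt_totalSpace]
  refine ⟨contDiff_fst.contMDiff.contMDiffAt, ?_⟩
  have : (fun q : F × F => ((trivializationAt F (TangentSpace 𝓘(ℝ, F)) p.1)
      (⟨q.1, q.2⟩ : TangentBundle 𝓘(ℝ, F) F)).2) = Prod.snd := by
    funext q
    simp
  exact contDiff_snd.contMDiff.contMDiffAt.congr_of_eventuallyEq (Filter.EventuallyEq.of_eq this)

variable {m : ℕ} {M : Type*} [TopologicalSpace M] [ChartedSpace (Euc (m + 1)) M]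
  [IsManifold (𝓡 (m + 1)) ∞ M]

/-- The square of the length of `df_z(w)` depends on `(z, w)` with the regularity of the metric,
here capped at `C³`. -/
theorem contDiffOn_metric_mfderiv {F : Type*} [NormedAddCommGroup F] [NormedSpace ℝ F] {k : ℕ∞}
    (hk : 3 ≤ k) (g : CkMetric m M k) {f : F → M} {s : Set F} (hs : IsOpen s)
    (hf : ContMDiffOn 𝓘(ℝ, F) (𝓡 (m + 1)) ∞ f s) :
    ContDiffOn ℝ 3 (fun p : F × F => g.inner (f p.1) (mfderiv 𝓘(ℝ, F) (𝓡 (m + 1)) f p.1 p.2)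
      (mfderiv 𝓘(ℝ, F) (𝓡 (m + 1)) f p.1 p.2)) (Prod.fst ⁻¹' s) := by
  have hv : ContMDiffOn 𝓘(ℝ, F × F) (𝓡 (m + 1)).tangent 3
      (fun p : F × F => (⟨f p.1, mfderiv 𝓘(ℝ, F) (𝓡 (m + 1)) f p.1 p.2⟩ :
        TangentBundle (𝓡 (m + 1)) M)) (Prod.fst ⁻¹' s) := by
    have h := (hf.contMDiffOn_tangentMapWithin (m := 3) (by norm_cast) hs.uniqueMDiffOn).comp
      (contMDiff_tangentBundle_mk F).contMDiffOn (s := Prod.fst ⁻¹' s) (fun p hp => hp)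
    refine h.congr fun p hp => ?_
    simp only [Function.comp, tangentMapWithin]
    rw [mfderivWithin_of_isOpen hs hp]
  intro p hp
  refine ContMDiffWithinAt.contDiffWithinAt ?_
  have hb : ContMDiffWithinAt 𝓘(ℝ, F × F) (𝓡 (m + 1)) 3 (fun p : F × F => f p.1)
    (Prod.fst ⁻¹' s) p := (hf.of_le (by norm_cast)).comp contDiff_fst.contMDiff.contMDiffOn
      (fun _ hp => hp) p hp
  have hk' : (3 : WithTop ℕ∞) ≤ (k : WithTop ℕ∞) := WithTop.coe_le_coe.2 hk
  have := ContMDiffWithinAt.clm_bundle_apply₂ (F₁ := Euc (m + 1)) (F₂ := Euc (m + 1)) (F₃ := ℝ)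
    (E₁ := TangentSpace (𝓡 (m + 1))) (E₂ := TangentSpace (𝓡 (m + 1))) (E₃ := Bundle.Trivial M ℝ)
    (b := fun p : F × F => f p.1) (ψ := fun p => g.inner (f p.1))
    (ContMDiffAt.comp_contMDiffWithinAt p (g.contMDiff.contMDiffAt.of_le hk') hb)
    (hv p hp) (hv p hp)
  rw [contMDiffWithinAt_totalSpace] at this
  exact this.2

namespace NetChart

variable {V E : Type*} {Γ : WeightedMultigraph V E} {γ₀ : CkMetric m M ⊤} (𝒞 : NetChart Γ γ₀)

/-- The coordinate region `(-δ_E, 1 + δ_E) × {|x| < δ_E}` of the tube of an edge. -/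
def tubeBox (e : E) : Set (Rn m) := {z | z.fst ∈ Ioo (-𝒞.δ e) (1 + 𝒞.δ e) ∧ ‖z.snd‖ < 𝒞.δ e}

theorem isOpen_tubeBox (e : E) : IsOpen (𝒞.tubeBox e) :=
  (isOpen_Ioo.preimage (WithLp.fstL 2 ℝ ℝ (Euc m)).continuous).inter
    (isOpen_lt (WithLp.sndL 2 ℝ ℝ (Euc m)).continuous.norm continuous_const)

theorem endBox_subset_tubeBox (p : E × Fin 2) : endBox m (𝒞.δ p.1) p.2 ⊆ 𝒞.tubeBox p.1 := by
  rintro z ⟨h1, h2⟩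
  refine ⟨?_, h2⟩
  have := 𝒞.δ_pos p.1
  rw [abs_lt] at h1
  obtain ⟨e, i⟩ := p
  fin_cases i
  · simp [WeightedMultigraph.endpoint] at h1 ⊢
    constructor <;> linarith
  · simp [WeightedMultigraph.endpoint] at h1 ⊢
    constructor <;> linarith

theorem isLocalDiffeomorphAt_tube {e : E} {z : Rn m} (hz : z ∈ 𝒞.tubeBox e) :
    IsLocalDiffeomorphAt 𝓘(ℝ, Rn m) (𝓡 (m + 1)) ∞ (𝒞.tube e) z :=
  𝒞.tube_localDiffeo e ⟨z, 𝒞.box_subset e z hz.1 hz.2⟩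

theorem contMDiffOn_tube (e : E) :
    ContMDiffOn 𝓘(ℝ, Rn m) (𝓡 (m + 1)) ∞ (𝒞.tube e) (𝒞.tubeBox e) := fun _ hz =>
  (𝒞.isLocalDiffeomorphAt_tube hz).contMDiffAt.contMDiffWithinAt

theorem mfderiv_tube_injective {e : E} {z : Rn m} (hz : z ∈ 𝒞.tubeBox e) :
    Function.Injective (mfderiv 𝓘(ℝ, Rn m) (𝓡 (m + 1)) (𝒞.tube e) z) :=
  ((𝒞.isLocalDiffeomorphAt_tube hz).mfderivToContinuousLinearEquiv (by simp)).injective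

theorem isLocalDiffeomorphAt_change (p : E × Fin 2) {z : Rn m}
    (hz : z ∈ endBox m (𝒞.δ p.1) p.2) :
    IsLocalDiffeomorphAt 𝓘(ℝ, Rn m) 𝓘(ℝ, Rn m) ∞ (𝒞.change p) z :=
  (𝒞.isLocalDiffeomorphAt_tube (𝒞.endBox_subset_tubeBox p hz)).comp 𝓘(ℝ, Rn m) (Rn m)
    (PartialDiffeomorph.isLocalDiffeomorphAt _ _ _ (𝒞.loc (Γ.vertex p)).symm
      (𝒞.loc_target p z hz))

theorem contDiffAt_change (p : E × Fin 2) {z : Rn m} (hz : z ∈ endBox m (𝒞.δ p.1) p.2) :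
    ContDiffAt ℝ ∞ (𝒞.change p) z :=
  (𝒞.isLocalDiffeomorphAt_change p hz).contMDiffAt.contDiffAt

theorem isInvertible_fderiv_change (p : E × Fin 2) {z : Rn m}
    (hz : z ∈ endBox m (𝒞.δ p.1) p.2) : (fderiv ℝ (𝒞.change p) z).IsInvertible := by
  rw [← mfderiv_eq_fderiv]
  exact ⟨(𝒞.isLocalDiffeomorphAt_change p hz).mfderivToContinuousLinearEquiv (by simp), rfl⟩

/-! ### The Lagrangian of the length functional -/

/-- The Lagrangian of an edge as a function of all its variables. -/
def lagrFun {k : ℕ∞} (g : CkMetric m M k) (e : E) (q : LagrSpace m) : ℝ :=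
  𝒞.lagr g e q.1 q.2.1 q.2.2.1 q.2.2.2.1 q.2.2.2.2

/-- The region in which the Lagrangian of an edge is of class `C³`: the point lies in the tube, and
the velocity has a nonvanishing component along the edge. -/
def lagrDomain (e : E) : Set (LagrSpace m) :=
  {q | (WithLp.toLp 2 (q.2.1 * (1 - q.1) + q.2.2.1 * q.1, q.2.2.2.1) : Rn m) ∈ 𝒞.tubeBox e ∧
    q.2.2.1 - q.2.1 ≠ 0}

theorem isOpen_lagrDomain (e : E) : IsOpen (𝒞.lagrDomain e) := by
  refine ((𝒞.isOpen_tubeBox e).preimage ?_).inter (isOpen_ne_fun (by fun_prop) continuous_const)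
  exact (WithLp.prod_continuous_toLp 2 ℝ (Euc m)).comp (by fun_prop)

theorem contDiffOn_lagrFun {k : ℕ∞} (hk : 3 ≤ k) (g : CkMetric m M k) (e : E) :
    ContDiffOn ℝ 3 (𝒞.lagrFun g e) (𝒞.lagrDomain e) := by
  have hto : ContDiff ℝ 3 (WithLp.toLp 2 : ℝ × Euc m → Rn m) :=
    (WithLp.prodContinuousLinearEquiv 2 ℝ ℝ (Euc m)).symm.contDiff
  have hκ : ContDiff ℝ 3 (fun q : LagrSpace m =>
      ((WithLp.toLp 2 (q.2.1 * (1 - q.1) + q.2.2.1 * q.1, q.2.2.2.1),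
        WithLp.toLp 2 (q.2.2.1 - q.2.1, q.2.2.2.2)) : Rn m × Rn m)) :=
    (hto.comp (by fun_prop)).prodMk (hto.comp (by fun_prop))
  refine ((contDiffOn_metric_mfderiv hk g (𝒞.isOpen_tubeBox e) (𝒞.contMDiffOn_tube e)).comp
    hκ.contDiffOn fun q hq => hq.1).sqrt fun q hq => ?_
  refine (g.pos _ _ fun h => hq.2 ?_).ne'
  have := 𝒞.mfderiv_tube_injective hq.1 (h.trans (map_zero _).symm)
  exact congrArg WithLp.fst this

/-- The pullback of the metric under the tube map, as a positive definite bilinear form. -/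
theorem exists_speed_eq {k : ℕ∞} (g : CkMetric m M k) {e : E} {z : Rn m}
    (hz : z ∈ 𝒞.tubeBox e) : ∃ Q : Rn m →ₗ[ℝ] Rn m →ₗ[ℝ] ℝ, (∀ v w, Q v w = Q w v) ∧
      (∀ v, v ≠ 0 → 0 < Q v v) ∧ ∀ v, 𝒞.speed g e z v = Real.sqrt (Q v v) := by
  obtain ⟨D, hD⟩ : ∃ D : Rn m →L[ℝ] Euc (m + 1),
    D = mfderiv 𝓘(ℝ, Rn m) (𝓡 (m + 1)) (𝒞.tube e) z := ⟨_, rfl⟩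
  obtain ⟨B, hB⟩ : ∃ B : Euc (m + 1) →L[ℝ] Euc (m + 1) →L[ℝ] ℝ,
    B = g.inner (𝒞.tube e z) := ⟨_, rfl⟩
  have hinj : Function.Injective D := by
    rw [hD]
    exact 𝒞.mfderiv_tube_injective hz
  have hpos : ∀ v, v ≠ 0 → 0 < B v v := by
    rw [hB]
    exact g.pos _
  have hsymm : ∀ v w, B v w = B w v := by
    rw [hB]
    exact g.symm _
  refine ⟨LinearMap.mk₂ ℝ (fun v w => B (D v) (D w)) (by simp) (by simp) (by simp) (by simp),
    fun v w => hsymm _ _, fun v hv => hpos _ ((map_ne_zero_iff D hinj).2 hv), fun v => ?_⟩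
  rw [LinearMap.mk₂_apply, hD, hB]
  rfl

/-- The Legendre condition: the Hessian of the Lagrangian in the velocity is nondegenerate. On a
line the square of the Lagrangian is a quadratic polynomial, and by the strict Cauchy-Schwarz
inequality its discriminant does not vanish since `(b - a, w)` and `(0, ζ)` are independent. -/
theorem eq_zero_of_fderiv_gradVel_lagrFun_eq_zero {k : ℕ∞} (hk : 3 ≤ k) (g : CkMetric m M k)
    {e : E} {q : LagrSpace m} (hq : q ∈ 𝒞.lagrDomain e) {ζ : Euc m}
    (h : fderiv ℝ (gradVel (𝒞.lagrFun g e)) q (LagrSpace.inVel m ζ) = 0) : ζ = 0 := by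
  obtain ⟨t, a, b, x, w⟩ := q
  set z : Rn m := WithLp.toLp 2 (a * (1 - t) + b * t, x) with hz
  have hzb : z ∈ 𝒞.tubeBox e := hq.1
  have hab : b - a ≠ 0 := hq.2
  obtain ⟨Q, hsymm, hQ, hspeed⟩ := 𝒞.exists_speed_eq g hzb
  set v₀ : Rn m := WithLp.toLp 2 (b - a, w) with hv₀
  set ξ₀ : Rn m := WithLp.toLp 2 (0, ζ) with hξ₀
  have hv₀0 : v₀ ≠ 0 := fun h0 => hab (congrArg WithLp.fst h0)
  have hpos := hQ v₀ hv₀0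
  have hsq : ∀ s : ℝ, 𝒞.lagrFun g e ((t, a, b, x, w) + s • LagrSpace.inVel m ζ) ^ 2 =
      Q v₀ v₀ + 2 * Q v₀ ξ₀ * s + Q ξ₀ ξ₀ * s ^ 2 := by
    intro s
    have e1 : 𝒞.lagrFun g e ((t, a, b, x, w) + s • LagrSpace.inVel m ζ) =
        𝒞.speed g e z (v₀ + s • ξ₀) := by
      have hv : v₀ + s • ξ₀ = WithLp.toLp 2 (b - a, w + s • ζ) := by
        rw [hv₀, hξ₀, ← WithLp.toLp_smul, ← WithLp.toLp_add]
        simp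
      have hq' : ((t, a, b, x, w) : LagrSpace m) + s • LagrSpace.inVel m ζ =
          (t, a, b, x, w + s • ζ) := by
        simp [LagrSpace.inVel_apply]
      rw [hv, hq']
      rfl
    have hnn : 0 ≤ Q (v₀ + s • ξ₀) (v₀ + s • ξ₀) := by
      by_cases h0 : v₀ + s • ξ₀ = 0
      · rw [h0]; simp
      · exact (hQ _ h0).le
    rw [e1, hspeed, Real.sq_sqrt hnn]
    simp only [map_add, map_smul, LinearMap.add_apply, LinearMap.smul_apply, smul_eq_mul,
      hsymm ξ₀ v₀]
    ring
  have key := sq_eq_mul_of_fderiv_gradVel_eq_zero (𝒞.isOpen_lagrDomain e)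
    (𝒞.contDiffOn_lagrFun hk g e) hq hsq h
  -- Equality in the Cauchy-Schwarz inequality: `Q v₀ v₀ • ξ₀ - Q v₀ ξ₀ • v₀` has length zero.
  have h0 : Q v₀ v₀ • ξ₀ - Q v₀ ξ₀ • v₀ = 0 := by
    by_contra hne
    have := hQ _ hne
    simp only [map_sub, map_smul, LinearMap.sub_apply, LinearMap.smul_apply, smul_eq_mul,
      hsymm ξ₀ v₀] at this
    have e : Q v₀ v₀ * (Q v₀ v₀ * Q ξ₀ ξ₀) - Q v₀ v₀ * Q v₀ ξ₀ ^ 2 = 0 := by rw [key]; ring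
    nlinarith
  have hfst : Q v₀ v₀ * 0 - Q v₀ ξ₀ * (b - a) = 0 := congrArg WithLp.fst h0
  have hsnd : Q v₀ v₀ • ζ - Q v₀ ξ₀ • w = 0 := congrArg WithLp.snd h0
  have hβ : Q v₀ ξ₀ = 0 := by
    rw [mul_zero, zero_sub, neg_eq_zero] at hfst
    exact (mul_eq_zero.1 hfst).resolve_right hab
  rw [hβ, zero_smul, sub_zero] at hsnd
  exact (smul_eq_zero.1 hsnd).resolve_left hpos.ne'

/-! ### The mean curvature map in terms of the second-order data -/

/-- As `δ_E < 1/2`, the parameters of a point of `U` satisfy `a_E < b_E`. -/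
theorem edgeCurve_mem_lagrDomain {u : ModelSpace E m} (hu : u ∈ 𝒞.U) (e : E) (t : unitInterval) :
    (edgeCurve (u e) t).1 ∈ 𝒞.lagrDomain e := by
  obtain ⟨h1, h2, h3⟩ := hu e
  have ht0 : (0 : ℝ) ≤ t := t.2.1
  have ht1 : (t : ℝ) ≤ 1 := t.2.2
  have hh := 𝒞.δ_lt_half e
  rw [abs_lt] at h1 h2
  rw [edgeCurve_apply]
  refine ⟨⟨⟨?_, ?_⟩, (C2Path.norm_pathVal_le _ _).trans_lt h3⟩, ?_⟩
  · change -𝒞.δ e < (u e).1 * (1 - t) + (u e).2.1 * t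
    nlinarith
  · change (u e).1 * (1 - t) + (u e).2.1 * t < 1 + 𝒞.δ e
    nlinarith
  · change (u e).2.1 - (u e).1 ≠ 0
    intro h
    linarith

/-- The derivative of the Lagrangian in `a` (for `i = 0`) or `b` (for `i = 1`), as a function of the
second-order data. -/
def lagrDeriv {k : ℕ∞} (g : CkMetric m M k) (e : E) (i : Fin 2) (p : LagrSpace m × Euc m) : ℝ :=
  fderiv ℝ (𝒞.lagrFun g e) p.1 (LagrSpace.inParam m (if i = 0 then (1, 0) else (0, 1)))

theorem contDiffOn_lagrDeriv {k : ℕ∞} (hk : 3 ≤ k) (g : CkMetric m M k) (e : E) (i : Fin 2) :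
    ContDiffOn ℝ 1 (𝒞.lagrDeriv g e i) (𝒞.lagrDomain e ×ˢ univ) :=
  ((((𝒞.contDiffOn_lagrFun hk g e).fderiv_of_isOpen (m := 2) (𝒞.isOpen_lagrDomain e)
    (by norm_num)).of_le (by norm_num)).comp contDiff_fst.contDiffOn
      fun _ hp => hp.1).clm_apply contDiffOn_const

section

variable {k : ℕ∞} (hk : 3 ≤ k) (g : CkMetric m M k) {u : ModelSpace E m} (hu : u ∈ 𝒞.U) (e : E)
include hk hu

theorem differentiableAt_lagrFun (t : unitInterval) :
    DifferentiableAt ℝ (𝒞.lagrFun g e)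
      ((t : ℝ), (u e).1, (u e).2.1, pathVal (u e).2.2 t, pathDer (u e).2.2 t) := by
  have := 𝒞.edgeCurve_mem_lagrDomain hu e t
  rw [edgeCurve_apply] at this
  exact ((𝒞.contDiffOn_lagrFun hk g e).contDiffAt
    ((𝒞.isOpen_lagrDomain e).mem_nhds this)).differentiableAt (by norm_num)

theorem gradU_eq (t : unitInterval) :
    𝒞.gradU g u e t = gradPos (𝒞.lagrFun g e) (edgeCurve (u e) t).1 := by
  rw [edgeCurve_apply]
  exact gradient_pos_eq (𝒞.differentiableAt_lagrFun hk g hu e t)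

theorem gradW_eq (t : unitInterval) :
    𝒞.gradW g u e t = gradVel (𝒞.lagrFun g e) (edgeCurve (u e) t).1 := by
  rw [edgeCurve_apply]
  exact gradient_vel_eq (𝒞.differentiableAt_lagrFun hk g hu e t)

theorem dEnd_eq (i : Fin 2) (t : unitInterval) :
    𝒞.dEnd g u (e, i) t = 𝒞.lagrDeriv g e i (edgeCurve (u e) t) := by
  rw [lagrDeriv, edgeCurve_apply, dEnd]
  split_ifs
  · exact deriv_left_eq (𝒞.differentiableAt_lagrFun hk g hu e t)
  · exact deriv_right_eq (𝒞.differentiableAt_lagrFun hk g hu e t)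

theorem hasDerivWithinAt_gradW (t : unitInterval) :
    HasDerivWithinAt (𝒞.gradW g u e) (fderiv ℝ (gradVel (𝒞.lagrFun g e)) (edgeCurve (u e) t).1
      (1, 0, 0, pathDer (u e).2.2 t, (C2Path.jet m (u e).2.2).2.2 t)) (Icc 0 1) t := by
  have hq : HasDerivWithinAt (fun s : ℝ => ((s, (u e).1, (u e).2.1, pathVal (u e).2.2 s,
      pathDer (u e).2.2 s) : LagrSpace m))
      (1, 0, 0, pathDer (u e).2.2 t, (C2Path.jet m (u e).2.2).2.2 t) (Icc 0 1) t := by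
    have h1 := C2Path.hasDerivWithinAt_pathDer (u e).2.2 t.2
    rw [extendI_coe] at h1
    exact (hasDerivWithinAt_id _ _).prodMk ((hasDerivWithinAt_const _ _ _).prodMk
      ((hasDerivWithinAt_const _ _ _).prodMk
        ((C2Path.hasDerivWithinAt_pathVal (u e).2.2 t.2).prodMk h1)))
  have hmem := 𝒞.edgeCurve_mem_lagrDomain hu e t
  have hd : DifferentiableAt ℝ (gradVel (𝒞.lagrFun g e)) (edgeCurve (u e) t).1 :=
    ((contDiffOn_gradVel (𝒞.isOpen_lagrDomain e) (𝒞.contDiffOn_lagrFun hk g e)).contDiffAt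
      ((𝒞.isOpen_lagrDomain e).mem_nhds hmem)).differentiableAt (by norm_num)
  rw [edgeCurve_apply] at hd ⊢
  have hc := hd.hasFDerivAt.comp_hasDerivWithinAt (t : ℝ) hq
  refine hc.congr (fun s hs => ?_) ?_
  · have := 𝒞.gradW_eq hk g hu e ⟨s, hs⟩
    rwa [edgeCurve_apply] at this
  · have := 𝒞.gradW_eq hk g hu e t
    rwa [edgeCurve_apply] at this

theorem eulerLagrange_eq (t : unitInterval) :
    𝒞.eulerLagrange g u e t =
      eulerLagrangeMap (𝒞.lagrFun g e) (Γ.mult e) (edgeCurve (u e) t) := by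
  rw [eulerLagrange, 𝒞.gradU_eq hk g hu e t, (𝒞.hasDerivWithinAt_gradW hk g hu e t).derivWithin
    (uniqueDiffOn_Icc zero_lt_one _ t.2), eulerLagrangeMap]
  rw [edgeCurve_apply]

theorem continuousOn_eulerLagrange : ContinuousOn (𝒞.eulerLagrange g u e) (Icc 0 1) :=
  continuousOn_Icc_of_eq (contDiffOn_eulerLagrangeMap (𝒞.isOpen_lagrDomain e)
    (𝒞.contDiffOn_lagrFun hk g e) (Γ.mult e)).continuousOn
    (fun t => ⟨𝒞.edgeCurve_mem_lagrDomain hu e t, trivial⟩) (𝒞.eulerLagrange_eq hk g hu e)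

theorem H1_eq : 𝒞.H1 g u e =
    superposition (eulerLagrangeMap (𝒞.lagrFun g e) (Γ.mult e)) (edgeCurve (u e)) := by
  ext1 t
  rw [H1, toC0_apply (𝒞.continuousOn_eulerLagrange hk g hu e), superposition_apply
    (contDiffOn_eulerLagrangeMap (𝒞.isOpen_lagrDomain e) (𝒞.contDiffOn_lagrFun hk g e)
      (Γ.mult e)).continuousOn fun t => ⟨𝒞.edgeCurve_mem_lagrDomain hu e t, trivial⟩]
  exact 𝒞.eulerLagrange_eq hk g hu e t

theorem continuousOn_dEnd (i : Fin 2) : ContinuousOn (𝒞.dEnd g u (e, i)) (Icc 0 1) :=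
  continuousOn_Icc_of_eq (𝒞.contDiffOn_lagrDeriv hk g e i).continuousOn
    (fun t => ⟨𝒞.edgeCurve_mem_lagrDomain hu e t, trivial⟩) (𝒞.dEnd_eq hk g hu e i)

theorem integral_dEnd_eq (i : Fin 2) : ∫ t in (0 : ℝ)..1, 𝒞.dEnd g u (e, i) t =
    primitive ℝ (superposition (𝒞.lagrDeriv g e i) (edgeCurve (u e))) 1 := by
  rw [primitive_apply]
  refine intervalIntegral.integral_congr fun t ht => ?_
  rw [uIcc_of_le zero_le_one] at ht
  rw [extendI_of_mem _ ht, superposition_apply (𝒞.contDiffOn_lagrDeriv hk g e i).continuousOn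
    (fun t => ⟨𝒞.edgeCurve_mem_lagrDomain hu e t, trivial⟩)]
  exact 𝒞.dEnd_eq hk g hu e i ⟨t, ht⟩

end

theorem endCoord_mem_endBox {u : ModelSpace E m} (hu : u ∈ 𝒞.U) (p : E × Fin 2) :
    endCoord u p ∈ endBox m (𝒞.δ p.1) p.2 := by
  obtain ⟨h1, h2, h3⟩ := hu p.1
  refine ⟨?_, (C2Path.norm_pathVal_le _ _).trans_lt h3⟩
  obtain ⟨e, i⟩ := p
  fin_cases i
  · simpa [endCoord, endParam, WeightedMultigraph.endpoint] using h1
  · simpa [endCoord, endParam, WeightedMultigraph.endpoint] using h2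

theorem isDefinedAt_of_mem_U {k : ℕ∞} (hk : 3 ≤ k) (g : CkMetric m M k)
    {u : ModelSpace E m} (hu : u ∈ 𝒞.U) : 𝒞.IsDefinedAt g u := by
  refine fun e => ⟨fun t ht => ?_, fun i => ?_, fun t ht => ?_,
    𝒞.continuousOn_eulerLagrange hk g hu e, fun i => ?_⟩
  · exact (𝒞.differentiableAt_lagrFun hk g hu e ⟨t, ht⟩).comp
      ((u e).1, (u e).2.1, pathVal (u e).2.2 t, pathDer (u e).2.2 t)
      ((differentiableAt_const t).prodMk differentiableAt_id)
  · refine ContinuousOn.intervalIntegrable ?_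
    rw [uIcc_of_le zero_le_one]
    exact 𝒞.continuousOn_dEnd hk g hu e i
  · exact (𝒞.hasDerivWithinAt_gradW hk g hu e ⟨t, ht⟩).differentiableWithinAt
  · have := 𝒞.endCoord_mem_endBox hu (e, i)
    exact ⟨(𝒞.contDiffAt_change (e, i) this).differentiableAt (by simp),
      𝒞.isInvertible_fderiv_change (e, i) this⟩

/-! ### The continuity defect -/

/-- The end coordinates `(c_i(E), u_E(i))`, as a continuous linear map. -/
def endCoordL [Fintype E] (m : ℕ) (p : E × Fin 2) : ModelSpace E m →L[ℝ] Rn m :=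
  (WithLp.prodContinuousLinearEquiv 2 ℝ ℝ (Euc m)).symm.toContinuousLinearMap.comp
    ((((if p.2 = 0 then ContinuousLinearMap.fst ℝ ℝ (ℝ × C2Path m) else
      (ContinuousLinearMap.fst ℝ ℝ (C2Path m)).comp (ContinuousLinearMap.snd ℝ ℝ _))).prod
      ((C2Path.evalL m (WeightedMultigraph.endpoint p.2)).comp
        ((ContinuousLinearMap.snd ℝ ℝ _).comp (ContinuousLinearMap.snd ℝ ℝ _)))).comp
      (ContinuousLinearMap.proj p.1))

theorem endCoordL_apply [Fintype E] (p : E × Fin 2) (u : ModelSpace E m) :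
    endCoordL m p u = endCoord u p := by
  obtain ⟨e, i⟩ := p
  fin_cases i <;> rfl

theorem hasFDerivAt_endCoord [Fintype E] (p : E × Fin 2) (u : ModelSpace E m) :
    HasFDerivAt (fun u => endCoord u p) (endCoordL m p) u :=
  (endCoordL m p).hasFDerivAt.congr_of_eventuallyEq
    (Filter.Eventually.of_forall fun v => (endCoordL_apply p v).symm)

/-- The end coordinates at the different edge ends can be prescribed independently. -/
theorem exists_endCoord_eq (y : E × Fin 2 → Rn m) :
    ∃ X : ModelSpace E m, ∀ p, endCoord X p = y p := by
  choose X _ hX0 _ _ hX using fun e => C2Path.exists_jet_eq (m := m) 0 (y (e, 0)).snd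
    ((y (e, 1)).snd - (y (e, 0)).snd)
  refine ⟨fun e => ((y (e, 0)).fst, (y (e, 1)).fst, X e), ?_⟩
  rintro ⟨e, i⟩
  fin_cases i
  · have : pathVal (X e) ((WeightedMultigraph.endpoint 0 : unitInterval) : ℝ) = (y (e, 0)).snd :=
      hX0 e
    exact congrArg (fun x => (WithLp.toLp 2 ((y (e, 0)).fst, x) : Rn m)) this
  · have : pathVal (X e) ((WeightedMultigraph.endpoint 1 : unitInterval) : ℝ) = (y (e, 1)).snd := by
      change pathVal (X e) ((1 : unitInterval) : ℝ) = _
      rw [C2Path.pathVal_eq, extendI_coe, hX]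
      simp
    exact congrArg (fun x => (WithLp.toLp 2 ((y (e, 1)).fst, x) : Rn m)) this

section

variable [Fintype E]

/-- The derivative of the continuity defect at `u`. -/
def defectDeriv (u : ModelSpace E m) : ModelSpace E m →L[ℝ]
    ({p : E × Fin 2 // p ≠ 𝒞.pref (Γ.vertex p)} → Rn m) :=
  ContinuousLinearMap.pi fun p =>
    (fderiv ℝ (𝒞.change p.1) (endCoord u p.1)).comp (endCoordL m p.1) -
      endCoordL m (𝒞.pref (Γ.vertex p.1))

theorem hasFDerivAt_defect {u : ModelSpace E m} (hu : u ∈ 𝒞.U) :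
    HasFDerivAt 𝒞.defect (𝒞.defectDeriv u) u := by
  refine hasFDerivAt_pi.2 fun p => ?_
  have h3 := ((𝒞.contDiffAt_change p.1 (𝒞.endCoord_mem_endBox hu p.1)).differentiableAt
    (by simp)).hasFDerivAt
  exact (h3.comp u (hasFDerivAt_endCoord p.1 u)).sub
    (hasFDerivAt_endCoord (𝒞.pref (Γ.vertex p.1)) u)

theorem defectDeriv_surjective [DecidableEq E] {u : ModelSpace E m} (hu : u ∈ 𝒞.U) :
    Function.Surjective (𝒞.defectDeriv u) := by
  intro z
  choose D hD using fun p => 𝒞.isInvertible_fderiv_change p (𝒞.endCoord_mem_endBox hu p)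
  obtain ⟨X, hX⟩ := exists_endCoord_eq (m := m) fun p : E × Fin 2 =>
    if h : p ≠ 𝒞.pref (Γ.vertex p) then (D p).symm (z ⟨p, h⟩) else 0
  refine ⟨X, funext fun p => ?_⟩
  have h0 : endCoord X (𝒞.pref (Γ.vertex p.1)) = 0 := by
    rw [hX, dif_neg]
    rw [𝒞.vertex_pref]
    simp
  change fderiv ℝ (𝒞.change p.1) (endCoord u p.1) (endCoordL m p.1 X) -
    endCoordL m (𝒞.pref (Γ.vertex p.1)) X = _
  rw [endCoordL_apply, endCoordL_apply, h0, sub_zero, hX, dif_pos p.2, ← hD]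
  exact (D p.1).apply_symm_apply _

theorem isOpen_U : IsOpen 𝒞.U := by
  have : 𝒞.U = ⋂ e, {u : ModelSpace E m |
      |(u e).1| < 𝒞.δ e ∧ |(u e).2.1 - 1| < 𝒞.δ e ∧ ‖(u e).2.2‖ < 𝒞.δ e} := by
    ext u
    simp [U]
  rw [this]
  refine isOpen_iInter_of_finite fun e => ?_
  have h : Continuous fun u : ModelSpace E m => u e := continuous_apply e
  exact (isOpen_lt (continuous_fst.comp h).abs continuous_const).inter
    ((isOpen_lt ((continuous_fst.comp (continuous_snd.comp h)).sub continuous_const).abs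
      continuous_const).inter
      (isOpen_lt (continuous_snd.comp (continuous_snd.comp h)).norm continuous_const))

/-! ### The derivative of the mean curvature map -/

/-- The derivative of `H¹` at an edge is a linear second-order differential operator, whose leading
coefficient is invertible by the Legendre condition. -/
theorem exists_hasFDerivAt_H1 {k : ℕ∞} (hk : 3 ≤ k) (g : CkMetric m M k) {u : ModelSpace E m}
    (hu : u ∈ 𝒞.U) (e : E) :
    ∃ M : C(unitInterval, (LagrSpace m × Euc m) →L[ℝ] Euc m),
      (∀ t (ζ : Euc m), M t (0, ζ) = 0 → ζ = 0) ∧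
      HasFDerivAt (fun u => 𝒞.H1 g u e)
        (((clmPointwise M).comp (edgeJet m)).comp (ContinuousLinearMap.proj e)) u := by
  have hΩ := 𝒞.isOpen_lagrDomain e
  have hℓ := 𝒞.contDiffOn_lagrFun hk g e
  have hN := contDiffOn_eulerLagrangeMap hΩ hℓ (Γ.mult e)
  have hmem : ∀ t, edgeCurve (u e) t ∈ 𝒞.lagrDomain e ×ˢ (univ : Set (Euc m)) := fun t =>
    ⟨𝒞.edgeCurve_mem_lagrDomain hu e t, trivial⟩
  obtain ⟨M, hM⟩ := exists_fderiv_along (hΩ.prod isOpen_univ) hN hmem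
  refine ⟨M, fun t ζ h => ?_, ?_⟩
  · rw [hM, fderiv_eulerLagrangeMap_inr hΩ hℓ _ (hmem t).1, neg_eq_zero, smul_eq_zero] at h
    have hmult : (Γ.mult e : ℝ) ≠ 0 := Nat.cast_ne_zero.2 (Γ.mult_pos e).ne'
    exact 𝒞.eq_zero_of_fderiv_gradVel_lagrFun_eq_zero hk g (hmem t).1 (h.resolve_left hmult)
  · have h := (hasFDerivAt_superposition_edgeCurve (hΩ.prod isOpen_univ) hN hmem hM).comp u
      (ContinuousLinearMap.proj (R := ℝ) (φ := fun _ : E => ℝ × ℝ × C2Path m) e).hasFDerivAt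
    refine h.congr_of_eventuallyEq ?_
    filter_upwards [𝒞.isOpen_U.mem_nhds hu] with v hv
    exact 𝒞.H1_eq hk g hv e

theorem differentiableAt_A {k : ℕ∞} (hk : 3 ≤ k) (g : CkMetric m M k) {u : ModelSpace E m}
    (hu : u ∈ 𝒞.U) (p : E × Fin 2) : DifferentiableAt ℝ (fun u => 𝒞.A g u p) u := by
  obtain ⟨e, i⟩ := p
  have hΩ := 𝒞.isOpen_lagrDomain e
  have hℓ := 𝒞.contDiffOn_lagrFun hk g e
  have hmem : ∀ t, edgeCurve (u e) t ∈ 𝒞.lagrDomain e ×ˢ (univ : Set (Euc m)) := fun t =>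
    ⟨𝒞.edgeCurve_mem_lagrDomain hu e t, trivial⟩
  have hpr : HasFDerivAt (fun u : ModelSpace E m => u e)
      (ContinuousLinearMap.proj (R := ℝ) (φ := fun _ : E => ℝ × ℝ × C2Path m) e) u :=
    (ContinuousLinearMap.proj (R := ℝ) (φ := fun _ : E => ℝ × ℝ × C2Path m) e).hasFDerivAt
  have hint : DifferentiableAt ℝ (fun u => ∫ t in (0 : ℝ)..1, 𝒞.dEnd g u (e, i) t) u := by
    have hN := 𝒞.contDiffOn_lagrDeriv hk g e i
    obtain ⟨M, hM⟩ := exists_fderiv_along (hΩ.prod isOpen_univ) hN hmem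
    have h := (hasFDerivAt_superposition_edgeCurve (hΩ.prod isOpen_univ) hN hmem hM).comp u hpr
    have h' := (((ContinuousMap.evalCLM ℝ (1 : unitInterval)).comp (primitive ℝ)).hasFDerivAt).comp
      u h
    refine h'.differentiableAt.congr_of_eventuallyEq ?_
    filter_upwards [𝒞.isOpen_U.mem_nhds hu] with v hv
    exact 𝒞.integral_dEnd_eq hk g hv e i
  have hgrad : ∀ t : unitInterval, DifferentiableAt ℝ (fun u => 𝒞.gradW g u e t) u := by
    intro t
    have h0 := ((ContinuousLinearMap.fst ℝ (LagrSpace m) (Euc m)).comp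
      (ContinuousMap.evalCLM ℝ t)).hasFDerivAt.comp u ((hasFDerivAt_edgeCurve (u e)).comp u hpr)
    have h1 : DifferentiableAt ℝ (fun u : ModelSpace E m => (edgeCurve (u e) t).1) u :=
      h0.differentiableAt
    have h2 : DifferentiableAt ℝ (gradVel (𝒞.lagrFun g e)) (edgeCurve (u e) t).1 :=
      ((contDiffOn_gradVel hΩ hℓ).contDiffAt (hΩ.mem_nhds (hmem t).1)).differentiableAt
        (by norm_num)
    refine (h2.comp u h1).congr_of_eventuallyEq ?_
    filter_upwards [𝒞.isOpen_U.mem_nhds hu] with v hv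
    exact 𝒞.gradW_eq hk g hv e t
  have hsnd : DifferentiableAt ℝ
      (fun u => if i = 0 then -𝒞.gradW g u e 0 else 𝒞.gradW g u e 1) u := by
    split_ifs
    · exact (hgrad 0).neg
    · exact hgrad 1
  exact ((WithLp.prodContinuousLinearEquiv 2 ℝ ℝ (Euc m)).symm.differentiable.differentiableAt.comp
    u (hint.prodMk hsnd)).const_smul (Γ.mult e : ℝ)

theorem differentiableAt_T {u : ModelSpace E m} (hu : u ∈ 𝒞.U) (p : E × Fin 2) :
    DifferentiableAt ℝ (fun u => 𝒞.T u p) u := by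
  have hmem := 𝒞.endCoord_mem_endBox hu p
  have h2 : DifferentiableAt ℝ (fderiv ℝ (𝒞.change p)) (endCoord u p) :=
    ((𝒞.contDiffAt_change p hmem).fderiv_right (m := 1) (by norm_cast)).differentiableAt
      (by norm_num)
  have h3 : DifferentiableAt ℝ ContinuousLinearMap.inverse
      (fderiv ℝ (𝒞.change p) (endCoord u p)) :=
    ((𝒞.isInvertible_fderiv_change p hmem).contDiffAt_map_inverse (n := 1)).differentiableAt
      (by norm_num)
  exact h3.comp u (h2.comp u (hasFDerivAt_endCoord p u).differentiableAt)

theorem differentiableAt_H2 [DecidableEq V] {k : ℕ∞} (hk : 3 ≤ k) (g : CkMetric m M k)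
    {u : ModelSpace E m} (hu : u ∈ 𝒞.U) (v : V) : DifferentiableAt ℝ (fun u => 𝒞.H2 g u v) u := by
  refine DifferentiableAt.fun_sum fun p _ => ?_
  have h := (adjointL m).differentiableAt.comp u (𝒞.differentiableAt_T hu p)
  exact h.clm_apply (𝒞.differentiableAt_A hk g hu p)

theorem differentiableAt_H [Fintype V] [DecidableEq V] {k : ℕ∞} (hk : 3 ≤ k) (g : CkMetric m M k)
    {u : ModelSpace E m} (hu : u ∈ 𝒞.U) : DifferentiableAt ℝ (𝒞.H g) u := by
  refine DifferentiableAt.prodMk (differentiableAt_pi.2 fun e => ?_)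
    (differentiableAt_pi.2 fun v => 𝒞.differentiableAt_H2 hk g hu v)
  obtain ⟨M, -, hM⟩ := 𝒞.exists_hasFDerivAt_H1 hk g hu e
  exact hM.differentiableAt

/-! ### The index -/

/-- There are `2|E| - |V|` edge ends other than the preferred ones. -/
theorem card_nonpref_add_card [DecidableEq E] [Fintype V] :
    Fintype.card {p : E × Fin 2 // p ≠ 𝒞.pref (Γ.vertex p)} + Fintype.card V =
      2 * Fintype.card E := by
  have h1 : Fintype.card {p : E × Fin 2 // p = 𝒞.pref (Γ.vertex p)} = Fintype.card V :=
    Fintype.card_congr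
      { toFun := fun p => Γ.vertex p.1
        invFun := fun v => ⟨𝒞.pref v, by rw [𝒞.vertex_pref]⟩
        left_inv := fun p => Subtype.ext p.2.symm
        right_inv := fun v => 𝒞.vertex_pref v }
  have h2 := Fintype.card_subtype_compl fun p : E × Fin 2 => p = 𝒞.pref (Γ.vertex p)
  have h3 := Fintype.card_subtype_le fun p : E × Fin 2 => p = 𝒞.pref (Γ.vertex p)
  rw [h1] at h2 h3
  rw [Fintype.card_prod, Fintype.card_fin] at h2 h3
  have h4 : Fintype.card {p : E × Fin 2 // p ≠ 𝒞.pref (Γ.vertex p)} =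
    Fintype.card {p : E × Fin 2 // ¬ p = 𝒞.pref (Γ.vertex p)} := rfl
  omega

/-- The linearized equations on the edges are uniquely solvable for prescribed initial data, whose
number is `2n` per edge. This is the number `n (2|E| - |V|) + n |V|` of the linearized matching
conditions at the vertices and of the vertex components of the mean curvature. -/
theorem isFredholmOfIndexZero_D₂H [DecidableEq E] [Fintype V] [DecidableEq V] {k : ℕ∞} (hk : 3 ≤ k)
    (g : CkMetric m M k) {u : ModelSpace E m} (hu : u ∈ 𝒞.U) :
    IsFredholmOfIndexZero (𝒞.D₂H g u) := by
  have hC : fderiv ℝ 𝒞.defect u = 𝒞.defectDeriv u := (𝒞.hasFDerivAt_defect hu).fderiv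
  choose M hM hMd using 𝒞.exists_hasFDerivAt_H1 hk g hu
  have hF : ∀ X e, (fderiv ℝ (𝒞.H g) u X).1 e = clmPointwise (M e) (edgeJet m (X e)) := by
    intro X e
    have h1 := ((ContinuousLinearMap.proj (R := ℝ)
      (φ := fun _ : E => C(unitInterval, Euc m)) e).comp
      (ContinuousLinearMap.fst ℝ _ (V → Rn m))).hasFDerivAt.comp u
        (𝒞.differentiableAt_H hk g hu).hasFDerivAt
    exact DFunLike.congr_fun (h1.unique (hMd e)) X
  let ι : ModelSpace E m →ₗ[ℝ] (E → ℝ × ℝ × Euc m × Euc m) :=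
    LinearMap.pi fun e => (edgeInit m).comp (LinearMap.proj e)
  have hb := fun e => bijective_edgeJet_edgeInit (M e) (hM e)
  refine isFredholmOfIndexZero_prod_comp_subtypeL (fderiv ℝ (𝒞.H g) u) ι (fderiv ℝ 𝒞.defect u)
    ⟨fun X X' h => funext fun e => (hb e).1 ?_, fun y => ?_⟩ ?_ ?_
  · refine Prod.ext ?_ (congrFun (congrArg Prod.snd h) e)
    have := congrFun (congrArg Prod.fst h) e
    simp only [hF] at this
    exact this
  · choose X hX using fun e => (hb e).2 (y.1 e, y.2 e)
    refine ⟨X, Prod.ext (funext fun e => ?_) (funext fun e => congrArg Prod.snd (hX e))⟩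
    rw [hF]
    exact congrArg Prod.fst (hX e)
  · rw [hC]
    exact 𝒞.defectDeriv_surjective hu
  · rw [Module.finrank_pi_fintype, Module.finrank_pi_fintype, Module.finrank_pi_fintype]
    simp only [Module.finrank_prod, finrank_euclideanSpace_fin, Module.finrank_self, finrank_Rn,
      Finset.sum_const, Finset.card_univ, smul_eq_mul]
    rw [← add_mul, 𝒞.card_nonpref_add_card]
    ring

end

end NetChart

end

theorem mainTheorem5 {m : ℕ} {M : Type*} [TopologicalSpace M] [T2Space M]
    [SecondCountableTopology M] [ChartedSpace (Euc (m + 1)) M] [IsManifold (𝓡 (m + 1)) ∞ M]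
    {V E : Type*} [Fintype V] [Fintype E] [DecidableEq V] [DecidableEq E]
    (Γ : WeightedMultigraph V E) (hΓ : Γ.IsGoodStar)
    (γ₀ : CkMetric m M ⊤) (𝒞 : NetChart Γ γ₀) (h𝒞 : 𝒞.IsEmbedded)
    {k : ℕ∞} (hk : 3 ≤ k) (g : CkMetric m M k)
    (u₀ : ModelSpace E m) (hu₀ : u₀ ∈ 𝒞.C₀) (hH : 𝒞.H g u₀ = 0) :
    (∀ u ∈ 𝒞.U, 𝒞.IsDefinedAt g u) ∧
    DifferentiableAt ℝ 𝒞.defect u₀ ∧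
    DifferentiableAt ℝ (𝒞.H g) u₀ ∧
    IsFredholmOfIndexZero (𝒞.D₂H g u₀) :=
  ⟨fun _ hu => 𝒞.isDefinedAt_of_mem_U hk g hu, (𝒞.hasFDerivAt_defect hu₀.1).differentiableAt,
    𝒞.differentiableAt_H hk g hu₀.1, 𝒞.isFredholmOfIndexZero_D₂H hk g hu₀.1⟩
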